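/- Let $G$ be a connected (finite-dimensional, Hausdorff, real) Lie group with Lie algebra $\mathfrak g$; compactness is not needed. Let $P = S^1\times G\to S^1$ be the trivial right principal $G$-bundle, let $\mathcal A$ be the space of smooth connections on $P$ (connection one-forms $A\in\Omega^1(P;\mathfrak g)$), and let $\mathcal LG$ be the group of smooth maps $S^1\to G$ under pointwise multiplication. Both $\mathcal A$ and $\mathcal LG$ carry the $C^\infty$ topology. A loop $g\in\mathcal LG$ acts on $P$ by the automorphism $(z,x)\mapsto(z,g(z)x)$, and hence on $\mathcal A$ from the right by pullback, $A\mapsto g^*A$. Let $\mathsf G=(\mathcal A\times\mathcal LG\rightrightarrows\mathcal A)$ with $s(A,g)=A$, $t(A,g)=g^*A$, and let $\mathsf H=(G\times G\rightrightarrows G)$ with $s(x,h)=x$, $t(x,h)=h^{-1}xh$, both with the composition of action groupoids. A morphism $\Psi:\mathsf K\to\mathsf L$ of topological groupoids (continuous maps $\Psi_0,\Psi_1$ on objects and arrows commuting with the structure maps) is called Morita if the square formed by $\Psi_1:\mathsf K_1\to\mathsf L_1$, $\Psi_0\times\Psi_0$ and the maps $(s,t)$ is cartesian in topological spaces and $s\circ\pi_2:\mathsf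 K_0\,{}_{\Psi_0}\!\times_t\mathsf L_1\to\mathsf L_0$ is an open surjection. Two topological groupoids are Morita equivalent if some topological groupoid has Morita morphisms to both. Then $\mathsf G$ and $\mathsf H$ are topological groupoids, and they are Morita equivalent. More precisely, every $A\in\mathcal A$ has a unique holonomy $\mathrm{hol}(A)\in G$, namely the element such that the horizontal lift of the loop $\theta\mapsto e^{i\theta}$, $0\le\theta\le 2\pi$, starting at $(1,1)\in P$ ends at $(1,\mathrm{hol}(A))$; and $A\mapsto\mathrm{hol}(A)$, $(A,g)\mapsto(\mathrm{hol}(A),g(1))$ is a Morita morphism $\mathsf G\to\mathsf H$. -/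

import Mathlib

open scoped Manifold ContDiff

noncomputable section

/-! ### Topological groupoids -/

universe u₀ u₁ v₀ v₁

/-- A small groupoid whose sets of objects and of arrows are topological spaces. The arrow `a` goes
from `s a` to `t a`, and `m a b` is defined when the target of `a` equals the source of `b`. -/
structure SpaceGroupoid where
  Obj : Type u₀
  Arr : Type u₁
  [topObj : TopologicalSpace Obj]
  [topArr : TopologicalSpace Arr]
  s : Arr → Obj
  t : Arr → Obj
  e : Obj → Arr
  i : Arr → Arr
  m : {p : Arr × Arr // t p.1 = s p.2} → Arr
  s_e : ∀ x, s (e x) = x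
  t_e : ∀ x, t (e x) = x
  s_i : ∀ a, s (i a) = t a
  t_i : ∀ a, t (i a) = s a
  s_m : ∀ p, s (m p) = s p.1.1
  t_m : ∀ p, t (m p) = t p.1.2
  e_m : ∀ a, m ⟨(e (s a), a), t_e (s a)⟩ = a
  m_e : ∀ a, m ⟨(a, e (t a)), (s_e (t a)).symm⟩ = a
  m_i : ∀ a, m ⟨(a, i a), (s_i a).symm⟩ = e (s a)
  i_m : ∀ a, m ⟨(i a, a), t_i a⟩ = e (t a)
  assoc : ∀ (a b c : Arr) (hab : t a = s b) (hbc : t b = s c),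
    m ⟨(m ⟨(a, b), hab⟩, c), (t_m ⟨(a, b), hab⟩).trans hbc⟩ =
      m ⟨(a, m ⟨(b, c), hbc⟩), hab.trans (s_m ⟨(b, c), hbc⟩).symm⟩

attribute [instance] SpaceGroupoid.topObj SpaceGroupoid.topArr

namespace SpaceGroupoid

/-- A topological groupoid: all structure maps are continuous. -/
structure IsTopological (K : SpaceGroupoid.{u₀, u₁}) : Prop where
  continuous_s : Continuous K.s
  continuous_t : Continuous K.t
  continuous_e : Continuous K.e
  continuous_i : Continuous K.i
  continuous_m : Continuous K.m

/-- A morphism of topological groupoids: a pair of continuous maps which commute with the structure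
maps. -/
structure Hom (K : SpaceGroupoid.{u₀, u₁}) (L : SpaceGroupoid.{v₀, v₁}) where
  obj : K.Obj → L.Obj
  arr : K.Arr → L.Arr
  continuous_obj : Continuous obj
  continuous_arr : Continuous arr
  map_s : ∀ a, L.s (arr a) = obj (K.s a)
  map_t : ∀ a, L.t (arr a) = obj (K.t a)
  map_e : ∀ x, arr (K.e x) = L.e (obj x)
  map_i : ∀ a, arr (K.i a) = L.i (arr a)
  map_m : ∀ p : {p : K.Arr × K.Arr // K.t p.1 = K.s p.2},
    arr (K.m p) = L.m ⟨(arr p.1.1, arr p.1.2),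
      (map_t p.1.1).trans ((congrArg obj p.2).trans (map_s p.1.2).symm)⟩

namespace Hom

variable {K : SpaceGroupoid.{u₀, u₁}} {L : SpaceGroupoid.{v₀, v₁}}

/-- The fibre product of `Ψ₀ × Ψ₀ : K₀ × K₀ → L₀ × L₀` and `(s, t) : L₁ → L₀ × L₀`. -/
abbrev ArrowPullback (Ψ : Hom K L) : Type _ :=
  {q : (K.Obj × K.Obj) × L.Arr // (Ψ.obj q.1.1, Ψ.obj q.1.2) = (L.s q.2, L.t q.2)}

/-- The canonical map from the arrows of `K` to the fibre product. -/
def toArrowPullback (Ψ : Hom K L) (a : K.Arr) : Ψ.ArrowPullback :=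
  ⟨((K.s a, K.t a), Ψ.arr a), by rw [Ψ.map_s, Ψ.map_t]⟩

/-- The fibre product `K₀ ×_{Ψ₀, t} L₁`. -/
abbrev TargetPullback (Ψ : Hom K L) : Type _ := {q : K.Obj × L.Arr // Ψ.obj q.1 = L.t q.2}

/-- A Morita morphism of topological groupoids: the square formed by `Ψ₁`, `Ψ₀ × Ψ₀` and the two
maps `(s, t)` is cartesian in topological spaces, and `s ∘ π₂ : K₀ ×_{Ψ₀, t} L₁ → L₀` is an open
surjection. -/
structure IsMorita (Ψ : Hom K L) : Prop where
  cartesian : IsHomeomorph Ψ.toArrowPullback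
  isOpenMap : IsOpenMap fun q : Ψ.TargetPullback => L.s q.1.2
  surjective : Function.Surjective fun q : Ψ.TargetPullback => L.s q.1.2

end Hom

/-- Two topological groupoids are Morita equivalent if a third topological groupoid has Morita
morphisms to both of them. -/
def MoritaEquivalent (K : SpaceGroupoid.{u₀, u₁}) (L : SpaceGroupoid.{v₀, v₁}) : Prop :=
  ∃ (M : SpaceGroupoid.{max u₀ v₀, max u₁ v₁}) (Φ : Hom M K) (Ψ : Hom M L),
    M.IsTopological ∧ Φ.IsMorita ∧ Ψ.IsMorita

end SpaceGroupoid

/-- The action groupoid `X × Γ ⇉ X` of a right action of a group: `s (x, g) = x`,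
`t (x, g) = x · g` and `m ((x, g), (x · g, h)) = (x, g h)`. -/
def rightActionGroupoid {X : Type u₀} {Γ : Type u₁} [TopologicalSpace X] [TopologicalSpace Γ]
    [Group Γ] (act : X → Γ → X) (act_one : ∀ x, act x 1 = x)
    (act_mul : ∀ x g h, act x (g * h) = act (act x g) h) : SpaceGroupoid where
  Obj := X
  Arr := X × Γ
  s a := a.1
  t a := act a.1 a.2
  e x := (x, 1)
  i a := (act a.1 a.2, a.2⁻¹)
  m p := (p.1.1.1, p.1.1.2 * p.1.2.2)
  s_e _ := rfl
  t_e := act_one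
  s_i _ := rfl
  t_i a := by rw [← act_mul, mul_inv_cancel, act_one]
  s_m _ := rfl
  t_m p := by rw [act_mul, p.2]
  e_m a := by simp
  m_e a := by simp
  m_i a := by simp
  i_m a := by simp
  assoc a b c hab hbc := by simp [mul_assoc]

/-- The groupoid `G × G ⇉ G` of the conjugation action, `s (x, h) = x`, `t (x, h) = h⁻¹ x h`. -/
def conjugationGroupoid (G : Type u₀) [TopologicalSpace G] [Group G] : SpaceGroupoid :=
  rightActionGroupoid (X := G) (Γ := G) (fun x h => h⁻¹ * x * h) (by simp)
    (by intro x g h; simp [mul_assoc])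

/-! ### The trivial principal bundle over the circle, its connections and its gauge group -/

section Bundle

variable {E : Type*} [NormedAddCommGroup E] [NormedSpace ℝ E]
  {H : Type*} [TopologicalSpace H] (I : ModelWithCorners ℝ E H)
  (G : Type*) [TopologicalSpace G] [ChartedSpace H G] [Group G]

/-- The adjoint action of `g` on the Lie algebra: the derivative at `1` of `x ↦ g x g⁻¹`. -/
def lieAd {G : Type*} [TopologicalSpace G] [ChartedSpace H G] [Group G] (g : G)
    (X : GroupLieAlgebra I G) : GroupLieAlgebra I G :=
  mfderiv I I (fun x : G => g * x * g⁻¹) 1 X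

variable [LieGroup I ∞ G]

/-- A connection on the trivial right principal bundle `P = Circle × G → Circle`, as a `𝔤`-valued
one-form `A` on the total space: it is smooth (as a function on the tangent bundle of `P`), it
returns `X` on the fundamental vector field of `X ∈ 𝔤`, and `R_g^* A = Ad(g⁻¹) A` for the right
translation `R_g` by `g`. -/
structure CircleConnection where
  form : ∀ p : Circle × G, TangentSpace ((𝓡 1).prod I) p →L[ℝ] GroupLieAlgebra I G
  smooth : ContMDiff (M' := E) ((𝓡 1).prod I).tangent 𝓘(ℝ, E) ∞
    (fun v : TangentBundle ((𝓡 1).prod I) (Circle × G) => form v.1 v.2)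
  vertical : ∀ (p : Circle × G) (X : GroupLieAlgebra I G),
    form (p.1, p.2 * 1) (mfderiv I ((𝓡 1).prod I) (fun x : G => (p.1, p.2 * x)) 1 X) = X
  equivariant : ∀ (g : G) (p : Circle × G) (v : TangentSpace ((𝓡 1).prod I) p),
    form (p.1, p.2 * g)
        (mfderiv ((𝓡 1).prod I) ((𝓡 1).prod I) (fun q : Circle × G => (q.1, q.2 * g)) p v) =
      lieAd I g⁻¹ (form p v)

/-- The loop group of `G`: smooth maps from the circle to `G` with the pointwise product. -/
abbrev SmoothLoop : Type _ := C^∞⟮𝓡 1, Circle; I, G⟯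

variable {I G}

/-- The automorphism `(z, x) ↦ (z, g(z) x)` of the trivial bundle given by a loop `g`. -/
def SmoothLoop.gauge (g : SmoothLoop I G) (p : Circle × G) : Circle × G := (p.1, g p.1 * p.2)

theorem SmoothLoop.contMDiff_gauge (g : SmoothLoop I G) :
    ContMDiff ((𝓡 1).prod I) ((𝓡 1).prod I) ∞ g.gauge :=
  contMDiff_fst.prodMk ((g.contMDiff.comp contMDiff_fst).mul contMDiff_snd)

namespace CircleConnection

@[ext]
theorem ext {A B : CircleConnection I G} (h : ∀ p, A.form p = B.form p) : A = B := by
  cases A; cases B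
  congr
  exact funext h

/-- The pullback `g^* A` of a connection along the bundle automorphism given by a loop. -/
def pullback (A : CircleConnection I G) (g : SmoothLoop I G) : CircleConnection I G where
  form p := (A.form (g.gauge p)).comp (mfderiv ((𝓡 1).prod I) ((𝓡 1).prod I) g.gauge p)
  smooth := A.smooth.comp (g.contMDiff_gauge.contMDiff_tangentMap (m := ∞) le_rfl)
  vertical p X := by
    have hR : ContMDiff I ((𝓡 1).prod I) ∞ (fun x : G => (p.1, p.2 * x)) :=
      contMDiff_const.prodMk (contMDiff_const.mul contMDiff_id)
    have key : ∀ f : G → Circle × G, f = (fun x : G => (p.1, (g p.1 * p.2) * x)) →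
        A.form (f 1) (mfderiv I ((𝓡 1).prod I) f 1 X) = X := by
      rintro f rfl
      exact A.vertical (p.1, g p.1 * p.2) X
    have h := key (g.gauge ∘ fun x : G => (p.1, p.2 * x))
      (by funext x; simp [SmoothLoop.gauge, mul_assoc])
    rw [mfderiv_comp (I' := (𝓡 1).prod I) 1
      (g.contMDiff_gauge.mdifferentiableAt (by simp)) (hR.mdifferentiableAt (by simp))] at h
    exact h
  equivariant h p v := by
    have hR : ContMDiff ((𝓡 1).prod I) ((𝓡 1).prod I) ∞
        (fun q : Circle × G => (q.1, q.2 * h)) :=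
      contMDiff_fst.prodMk (contMDiff_snd.mul contMDiff_const)
    have hg := g.contMDiff_gauge
    have key : ∀ f : Circle × G → Circle × G,
        f = (fun q : Circle × G => (q.1, q.2 * h)) ∘ g.gauge →
        A.form (f p) (mfderiv ((𝓡 1).prod I) ((𝓡 1).prod I) f p v) =
          lieAd I h⁻¹ (A.form (g.gauge p)
            (mfderiv ((𝓡 1).prod I) ((𝓡 1).prod I) g.gauge p v)) := by
      rintro f rfl
      rw [mfderiv_comp (I' := (𝓡 1).prod I) p (hR.mdifferentiableAt (by simp))
        (hg.mdifferentiableAt (by simp))]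
      exact A.equivariant h (g.gauge p) _
    have h' := key (g.gauge ∘ fun q : Circle × G => (q.1, q.2 * h))
      (by funext q; simp [SmoothLoop.gauge, mul_assoc])
    rw [mfderiv_comp (I' := (𝓡 1).prod I) p (hg.mdifferentiableAt (by simp))
      (hR.mdifferentiableAt (by simp))] at h'
    exact h'

theorem pullback_one (A : CircleConnection I G) : A.pullback 1 = A := by
  have h1 : (1 : SmoothLoop I G).gauge = id := by
    funext p; simp [SmoothLoop.gauge]
  have key : ∀ (f : Circle × G → Circle × G) (p : Circle × G), f = id →
      ∀ v, A.form (f p) (mfderiv ((𝓡 1).prod I) ((𝓡 1).prod I) f p v) = A.form p v := by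
    rintro f p rfl v
    rw [mfderiv_id]
    rfl
  ext p v
  exact key _ p h1 v

theorem pullback_mul (A : CircleConnection I G) (g h : SmoothLoop I G) :
    A.pullback (g * h) = (A.pullback g).pullback h := by
  have hgh : (g * h).gauge = g.gauge ∘ h.gauge := by
    funext p; simp [SmoothLoop.gauge, mul_assoc]
  have key : ∀ (f : Circle × G → Circle × G) (p : Circle × G), f = g.gauge ∘ h.gauge →
      ∀ v, A.form (f p) (mfderiv ((𝓡 1).prod I) ((𝓡 1).prod I) f p v) =
        ((A.pullback g).pullback h).form p v := by
    rintro f p rfl v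
    rw [mfderiv_comp (I' := (𝓡 1).prod I) p (g.contMDiff_gauge.mdifferentiableAt (by simp))
      (h.contMDiff_gauge.mdifferentiableAt (by simp))]
    rfl
  ext p v
  exact key _ p hgh v

end CircleConnection

/-! ### The topologies -/

/-- The topology induced by a family of curves in a normed space, for the uniform convergence of
the curves and of all their derivatives. -/
abbrev smoothCurveTopology {X : Type*} {V : Type*} [NormedAddCommGroup V] [NormedSpace ℝ V]
    (a : X → ℝ → V) : TopologicalSpace X :=
  ⨅ k : ℕ, TopologicalSpace.induced (fun x => UniformFun.ofFun (iteratedDeriv k (a x)))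
    (inferInstance : TopologicalSpace (UniformFun ℝ V))

/-- The coefficient of the local expression of a connection: with the section `σ(z) = (z, 1)` of
the trivial bundle and the coordinate `θ ↦ exp(iθ)` of the circle, `σ^* A = coeff A dθ`. -/
def CircleConnection.coeff (A : CircleConnection I G) (θ : ℝ) : E :=
  A.form (Circle.exp θ, 1)
    (mfderiv 𝓘(ℝ, ℝ) ((𝓡 1).prod I) (fun τ : ℝ => (Circle.exp τ, (1 : G))) θ (1 : ℝ))

/-- The `C^∞` topology on the space of connections: uniform convergence of the local expression
`σ^* A`, a smooth `𝔤`-valued one-form on the circle, with all its derivatives. -/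
instance : TopologicalSpace (CircleConnection I G) :=
  smoothCurveTopology CircleConnection.coeff

/-- The left logarithmic derivative `g⁻¹ dg/dθ` of a loop, as a curve in the Lie algebra. -/
def SmoothLoop.logDeriv (g : SmoothLoop I G) (θ : ℝ) : E :=
  mfderiv 𝓘(ℝ, ℝ) I (fun τ : ℝ => (g (Circle.exp θ))⁻¹ * g (Circle.exp τ)) θ (1 : ℝ)

/-- The `C^∞` topology on the loop group: uniform convergence of loops with all their derivatives,
where the derivatives are read in the left trivialisation `TG = G × 𝔤` of the tangent bundle, in
which the velocity of `g` is `(g, g⁻¹ dg/dθ)`. -/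
instance : TopologicalSpace (SmoothLoop I G) :=
  TopologicalSpace.induced (fun g => (g : C(Circle, G))) ContinuousMap.compactOpen ⊓
    smoothCurveTopology SmoothLoop.logDeriv

variable (I G) in
/-- The action groupoid `𝒜 × LG ⇉ 𝒜` with `s (A, g) = A` and `t (A, g) = g^* A`. -/
def connectionGroupoid : SpaceGroupoid :=
  rightActionGroupoid (X := CircleConnection I G) (Γ := SmoothLoop I G)
    CircleConnection.pullback CircleConnection.pullback_one CircleConnection.pullback_mul

/-! ### Holonomy -/

/-- `x` is the holonomy of `A` around the circle, from the base point `(1, 1)` of the bundle: there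
is a horizontal lift `θ ↦ (exp(iθ), u θ)` of the loop which starts at `(1, 1)` and ends, after one
turn, at `(1, x)`. -/
def CircleConnection.HasHolonomy (A : CircleConnection I G) (x : G) : Prop :=
  ∃ u : ℝ → G, ContMDiff 𝓘(ℝ, ℝ) I ∞ u ∧ u 0 = 1 ∧ u (2 * Real.pi) = x ∧
    ∀ θ : ℝ, A.form (Circle.exp θ, u θ)
      (mfderiv 𝓘(ℝ, ℝ) ((𝓡 1).prod I) (fun τ : ℝ => (Circle.exp τ, u τ)) θ (1 : ℝ)) = 0

end Bundle

end

open Topology Filter Set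

set_option linter.unusedSectionVars false

noncomputable section

section ChartCalculus

variable {E : Type*} [NormedAddCommGroup E] [NormedSpace ℝ E]
  {H : Type*} [TopologicalSpace H] (I : ModelWithCorners ℝ E H)
  (G : Type*) [TopologicalSpace G] [ChartedSpace H G] [Group G]

/-- The chart of a Lie group at the identity. -/
def unitChart : PartialEquiv G E := extChartAt I (1 : G)

/-- The coordinates of the identity. -/
def unitCoord : E := unitChart I G 1

@[simp]
theorem unitChart_one : unitChart I G 1 = unitCoord I G := rfl

@[simp]
theorem mem_unitChart_source_one : (1 : G) ∈ (unitChart I G).source := mem_extChartAt_source _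

@[simp]
theorem unitChart_symm_unitCoord : (unitChart I G).symm (unitCoord I G) = 1 :=
  (unitChart I G).left_inv (mem_unitChart_source_one I G)

theorem unitCoord_mem_target : unitCoord I G ∈ (unitChart I G).target :=
  (unitChart I G).map_source (mem_unitChart_source_one I G)

theorem isOpen_unitChart_source : IsOpen (unitChart I G).source := isOpen_extChartAt_source _

theorem eventually_symm_leftInverse :
    ∀ᶠ x in 𝓝 (1 : G), (unitChart I G).symm (unitChart I G x) = x := by
  filter_upwards [extChartAt_source_mem_nhds (I := I) (1 : G)] with x hx
  exact (unitChart I G).left_inv hx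

theorem isOpen_unitChart_target [I.Boundaryless] : IsOpen (unitChart I G).target :=
  isOpen_extChartAt_target _

theorem unitChart_target_mem_nhds [I.Boundaryless] :
    (unitChart I G).target ∈ 𝓝 (unitCoord I G) := extChartAt_target_mem_nhds _

theorem eventually_symm_rightInverse [I.Boundaryless] :
    ∀ᶠ y in 𝓝 (unitCoord I G), unitChart I G ((unitChart I G).symm y) = y := by
  filter_upwards [unitChart_target_mem_nhds I G] with y hy
  exact (unitChart I G).right_inv hy

variable {G}

/-- `ξ` is the left logarithmic derivative `γ⁻¹ dγ/dτ` of the curve `γ` at the time `θ`. -/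
def HasLeftLogDerivAt (γ : ℝ → G) (ξ : E) (θ : ℝ) : Prop :=
  ContinuousAt γ θ ∧ HasDerivAt (fun τ => unitChart I G ((γ θ)⁻¹ * γ τ)) ξ θ

/-- The adjoint action as a continuous linear map. -/
def adjointCLM (g : G) : E →L[ℝ] E := mfderiv I I (fun x : G => g * x * g⁻¹) 1

variable (G) in
/-- The derivative at the identity of the adjoint action. -/
def adjointDeriv : E →L[ℝ] E →L[ℝ] E :=
  fderiv ℝ (fun y => adjointCLM I ((unitChart I G).symm y)) (unitCoord I G)

/-- The derivative of the left translation by `x`, from the identity to the unit chart. -/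
def leftTransDeriv (x : G) : E →L[ℝ] E :=
  fderiv ℝ (fun z => unitChart I G (x * (unitChart I G).symm z)) (unitCoord I G)

variable (G) in
/-- The left Maurer–Cartan form in the unit chart. -/
def maurerCartanChart (y : E) : E →L[ℝ] E :=
  fderiv ℝ (fun z => unitChart I G (((unitChart I G).symm y)⁻¹ * (unitChart I G).symm z)) y

variable {I}

theorem mfderiv_eq_fderiv_unitChart [I.Boundaryless] {f : G → G} (hf : MDifferentiableAt I I f 1)
    (h1 : f 1 = 1) :
    (mfderiv I I f 1 : E →L[ℝ] E) =
      fderiv ℝ (fun z => unitChart I G (f ((unitChart I G).symm z))) (unitCoord I G) := by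
  have h : mfderiv I I f 1 = (fderivWithin ℝ (writtenInExtChartAt I I 1 f) (range I)
    (unitCoord I G) : E →L[ℝ] E) := hf.mfderiv
  rw [I.range_eq_univ, fderivWithin_univ] at h
  rw [h]
  simp only [writtenInExtChartAt, h1]
  rfl

variable [LieGroup I ∞ G]

theorem contMDiffAt_unitChart {x : G} (hx : x ∈ (unitChart I G).source) :
    ContMDiffAt I 𝓘(ℝ, E) ∞ (unitChart I G) x :=
  contMDiffAt_extChartAt' (by rwa [unitChart, extChartAt_source] at hx)

theorem contMDiffAt_unitChart_symm [I.Boundaryless] {y : E} (hy : y ∈ (unitChart I G).target) :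
    ContMDiffAt 𝓘(ℝ, E) I ∞ (unitChart I G).symm y :=
  (contMDiffOn_extChartAt_symm (1 : G) y hy).contMDiffAt ((isOpen_unitChart_target I G).mem_nhds hy)

section Boundaryless

variable [I.Boundaryless]

/-- A `G`-valued expression is smooth in the unit chart where it takes values in its source. -/
theorem contDiffAt_unitChart_comp {V : Type*} [NormedAddCommGroup V] [NormedSpace ℝ V]
    {f : V → G} {v : V} (hf : ContMDiffAt 𝓘(ℝ, V) I ∞ f v) (hv : f v ∈ (unitChart I G).source) :
    ContDiffAt ℝ ∞ (fun w => unitChart I G (f w)) v :=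
  ((contMDiffAt_unitChart hv).comp v hf).contDiffAt

theorem contMDiffAt_symm_comp_fst {y z : E} (hy : y ∈ (unitChart I G).target) :
    ContMDiffAt 𝓘(ℝ, E × E) I ∞ (fun p : E × E => (unitChart I G).symm p.1) (y, z) :=
  ContMDiffAt.comp (y, z) (g := (unitChart I G).symm) (f := Prod.fst)
    (contMDiffAt_unitChart_symm hy) contDiff_fst.contMDiff.contMDiffAt

theorem contMDiffAt_symm_comp_snd {y z : E} (hz : z ∈ (unitChart I G).target) :
    ContMDiffAt 𝓘(ℝ, E × E) I ∞ (fun p : E × E => (unitChart I G).symm p.2) (y, z) :=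
  ContMDiffAt.comp (y, z) (g := (unitChart I G).symm) (f := Prod.snd)
    (contMDiffAt_unitChart_symm hz) contDiff_snd.contMDiff.contMDiffAt

/-- The derivative along curves through the identity, read in the unit chart. -/
theorem hasDerivAt_comp_of_unitChart {V : Type*} [NormedAddCommGroup V] [NormedSpace ℝ V]
    {f : G → V} {D : E →L[ℝ] V} {x : ℝ → G} {ξ : E} {θ : ℝ} (hx1 : x θ = 1)
    (hf : HasFDerivAt (fun y => f ((unitChart I G).symm y)) D (unitCoord I G))
    (hc : ContinuousAt x θ) (hx : HasDerivAt (fun τ => unitChart I G (x τ)) ξ θ) :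
    HasDerivAt (fun τ => f (x τ)) (D ξ) θ := by
  have h0 : unitChart I G (x θ) = unitCoord I G := by rw [hx1, unitChart_one]
  have h := HasFDerivAt.comp_hasDerivAt θ (by rw [h0]; exact hf) hx
  refine h.congr_of_eventuallyEq ?_
  have := hc.eventually (by rw [hx1]; exact eventually_symm_leftInverse I G)
  filter_upwards [this] with τ hτ
  simp [hτ]

theorem contDiffAt_chartMul {y z : E} (hy : y ∈ (unitChart I G).target)
    (hz : z ∈ (unitChart I G).target)
    (h : (unitChart I G).symm y * (unitChart I G).symm z ∈ (unitChart I G).source) :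
    ContDiffAt ℝ ∞ (fun p : E × E =>
      unitChart I G ((unitChart I G).symm p.1 * (unitChart I G).symm p.2)) (y, z) :=
  contDiffAt_unitChart_comp
    ((contMDiffAt_symm_comp_fst hy).mul (contMDiffAt_symm_comp_snd hz)) h

theorem contDiffAt_chartLeftDiv {y z : E} (hy : y ∈ (unitChart I G).target)
    (hz : z ∈ (unitChart I G).target)
    (h : ((unitChart I G).symm y)⁻¹ * (unitChart I G).symm z ∈ (unitChart I G).source) :
    ContDiffAt ℝ ∞ (fun p : E × E =>
      unitChart I G (((unitChart I G).symm p.1)⁻¹ * (unitChart I G).symm p.2)) (y, z) :=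
  contDiffAt_unitChart_comp
    ((contMDiffAt_symm_comp_fst hy).inv.mul (contMDiffAt_symm_comp_snd hz)) h

theorem hasFDerivAt_chartMul :
    HasFDerivAt (fun p : E × E =>
      unitChart I G ((unitChart I G).symm p.1 * (unitChart I G).symm p.2))
      (ContinuousLinearMap.fst ℝ E E + ContinuousLinearMap.snd ℝ E E)
      (unitCoord I G, unitCoord I G) := by
  have hd := (contDiffAt_chartMul (I := I) (G := G) (unitCoord_mem_target I G)
    (unitCoord_mem_target I G) (by simp)).differentiableAt (by simp)
  have hD := hd.hasFDerivAt
  set D := fderiv ℝ (fun p : E × E =>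
      unitChart I G ((unitChart I G).symm p.1 * (unitChart I G).symm p.2))
      (unitCoord I G, unitCoord I G)
  have h1 : D.comp (ContinuousLinearMap.inl ℝ E E) = ContinuousLinearMap.id ℝ E := by
    have := HasFDerivAt.comp (unitCoord I G) hD
      (f := fun y => (y, unitCoord I G)) (hasFDerivAt_prodMk_left (𝕜 := ℝ) (unitCoord I G) (unitCoord I G))
    refine this.unique ((hasFDerivAt_id _).congr_of_eventuallyEq ?_)
    filter_upwards [eventually_symm_rightInverse I G] with y hy
    simp [hy]
  have h2 : D.comp (ContinuousLinearMap.inr ℝ E E) = ContinuousLinearMap.id ℝ E := by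
    have := HasFDerivAt.comp (unitCoord I G) hD
      (hasFDerivAt_prodMk_right (𝕜 := ℝ) (unitCoord I G) (unitCoord I G))
    refine this.unique ((hasFDerivAt_id _).congr_of_eventuallyEq ?_)
    filter_upwards [eventually_symm_rightInverse I G] with y hy
    simp [hy]
  convert! hD using 1
  refine ContinuousLinearMap.ext fun p => ?_
  have e1 := DFunLike.congr_fun h1 p.1
  have e2 := DFunLike.congr_fun h2 p.2
  simp only [ContinuousLinearMap.comp_apply, ContinuousLinearMap.inl_apply,
    ContinuousLinearMap.inr_apply, ContinuousLinearMap.id_apply] at e1 e2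
  rw [add_apply, ContinuousLinearMap.coe_fst', ContinuousLinearMap.coe_snd']
  conv_lhs => rw [← e1, ← e2]
  rw [← map_add]
  simp

theorem hasFDerivAt_chartInv :
    HasFDerivAt (fun y : E => unitChart I G (((unitChart I G).symm y)⁻¹))
      (-ContinuousLinearMap.id ℝ E) (unitCoord I G) := by
  have hd : DifferentiableAt ℝ (fun y : E => unitChart I G (((unitChart I G).symm y)⁻¹))
      (unitCoord I G) :=
    (contDiffAt_unitChart_comp (contMDiffAt_unitChart_symm (unitCoord_mem_target I G)).inv
      (by simp)).differentiableAt (by simp)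
  have hD := hd.hasFDerivAt
  set D := fderiv ℝ (fun y : E => unitChart I G (((unitChart I G).symm y)⁻¹)) (unitCoord I G)
  have hp : HasFDerivAt (fun y : E => (y, unitChart I G (((unitChart I G).symm y)⁻¹)))
      ((ContinuousLinearMap.id ℝ E).prod D) (unitCoord I G) := (hasFDerivAt_id _).prodMk hD
  have hm := hasFDerivAt_chartMul (I := I) (G := G)
  have hc := HasFDerivAt.comp (unitCoord I G) (by simpa using hm) hp
  have h0 := hc.unique ((hasFDerivAt_const (unitCoord I G) (unitCoord I G)).congr_of_eventuallyEq
    (by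
      have hcont : ContinuousAt (fun y : E => ((unitChart I G).symm y)⁻¹) (unitCoord I G) :=
        (contMDiffAt_unitChart_symm (unitCoord_mem_target I G)).inv.continuousAt
      have := hcont.eventually (by simpa using eventually_symm_leftInverse I G)
      filter_upwards [this] with y hy
      simp [hy]))
  have : D = -ContinuousLinearMap.id ℝ E := by
    refine ContinuousLinearMap.ext fun v => ?_
    have := DFunLike.congr_fun h0 v
    simp only [ContinuousLinearMap.comp_apply, ContinuousLinearMap.prod_apply,
      add_apply, ContinuousLinearMap.coe_fst', ContinuousLinearMap.coe_snd',
      ContinuousLinearMap.id_apply, zero_apply] at this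
    simpa using (eq_neg_of_add_eq_zero_right this)
  rwa [this] at hD

theorem contMDiff_conj (g : G) : ContMDiff I I ∞ (fun x : G => g * x * g⁻¹) :=
  (contMDiff_const.mul contMDiff_id).mul contMDiff_const

theorem hasFDerivAt_chartConj (g : G) :
    HasFDerivAt (fun y : E => unitChart I G (g * (unitChart I G).symm y * g⁻¹))
      (adjointCLM I g) (unitCoord I G) := by
  rw [adjointCLM, mfderiv_eq_fderiv_unitChart ((contMDiff_conj g).mdifferentiableAt (by simp))
    (by simp)]
  refine DifferentiableAt.hasFDerivAt ?_
  refine (contDiffAt_unitChart_comp ((contMDiff_conj g).contMDiffAt.comp _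
    (contMDiffAt_unitChart_symm (unitCoord_mem_target I G))) (by simp)).differentiableAt (by simp)

theorem adjointCLM_one : adjointCLM I (1 : G) = ContinuousLinearMap.id ℝ E := by
  refine (hasFDerivAt_chartConj (1 : G)).unique ((hasFDerivAt_id _).congr_of_eventuallyEq ?_)
  filter_upwards [eventually_symm_rightInverse I G] with y hy
  simp [hy]

theorem adjointCLM_mul (g h : G) :
    adjointCLM I (g * h) = (adjointCLM I g).comp (adjointCLM I h) := by
  have e : (unitChart I G) (h * (unitChart I G).symm (unitCoord I G) * h⁻¹) = unitCoord I G := by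
    simp
  have hc := HasFDerivAt.comp (unitCoord I G) (by rw [e]; exact hasFDerivAt_chartConj g)
    (hasFDerivAt_chartConj h)
  refine (hasFDerivAt_chartConj (g * h)).unique (hc.congr_of_eventuallyEq ?_)
  have hcont : ContinuousAt (fun y => h * (unitChart I G).symm y * h⁻¹) (unitCoord I G) :=
    ((contMDiff_conj h).contMDiffAt.comp _
    (contMDiffAt_unitChart_symm (unitCoord_mem_target I G))).continuousAt
  have := hcont.eventually (by simpa using eventually_symm_leftInverse I G)
  filter_upwards [this] with y hy
  simp only [Function.comp_apply, hy]
  simp [mul_assoc]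

theorem adjointCLM_inv_comp (g : G) :
    (adjointCLM I g⁻¹).comp (adjointCLM I g) = ContinuousLinearMap.id ℝ E := by
  rw [← adjointCLM_mul, inv_mul_cancel, adjointCLM_one]

theorem adjointCLM_inv_apply (g : G) (ξ : E) : adjointCLM I g⁻¹ (adjointCLM I g ξ) = ξ :=
  DFunLike.congr_fun (adjointCLM_inv_comp g) ξ

theorem adjointCLM_apply_inv (g : G) (ξ : E) : adjointCLM I g (adjointCLM I g⁻¹ ξ) = ξ := by
  simpa using adjointCLM_inv_apply (I := I) g⁻¹ ξ

theorem contDiffAt_adjointCLM_symm :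
    ContDiffAt ℝ ∞ (fun y => adjointCLM I ((unitChart I G).symm y)) (unitCoord I G) := by
  have h1 : ContDiffAt ℝ ∞ (fun p : E × E => unitChart I G ((unitChart I G).symm p.1 *
      (unitChart I G).symm p.2 * ((unitChart I G).symm p.1)⁻¹)) (unitCoord I G, unitCoord I G) :=
    contDiffAt_unitChart_comp (((contMDiffAt_symm_comp_fst (unitCoord_mem_target I G)).mul
      (contMDiffAt_symm_comp_snd (unitCoord_mem_target I G))).mul
      (contMDiffAt_symm_comp_fst (unitCoord_mem_target I G)).inv) (by simp)
  have h2 := ContDiffAt.fderiv (m := ∞) (x₀ := unitCoord I G) (g := fun _ => unitCoord I G)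
    (f := fun y z => unitChart I G ((unitChart I G).symm y *
      (unitChart I G).symm z * ((unitChart I G).symm y)⁻¹)) h1 contDiffAt_const (by simp)
  refine h2.congr_of_eventuallyEq (Eventually.of_forall fun y => ?_)
  exact (hasFDerivAt_chartConj ((unitChart I G).symm y)).fderiv.symm

theorem hasFDerivAt_adjointCLM_symm :
    HasFDerivAt (fun y => adjointCLM I ((unitChart I G).symm y)) (adjointDeriv I G)
      (unitCoord I G) :=
  (contDiffAt_adjointCLM_symm.differentiableAt (by simp)).hasFDerivAt

theorem contMDiff_adjointCLM :
    ContMDiff I 𝓘(ℝ, E →L[ℝ] E) ∞ (fun g : G => adjointCLM I g) := by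
  have h1 : ContMDiffAt I 𝓘(ℝ, E →L[ℝ] E) ∞ (fun g : G => adjointCLM I g) 1 := by
    have := ContMDiffAt.comp (1 : G) (contDiffAt_adjointCLM_symm (I := I) (G := G)).contMDiffAt
      (contMDiffAt_unitChart (I := I) (mem_unitChart_source_one I G))
    refine this.congr_of_eventuallyEq ?_
    filter_upwards [eventually_symm_leftInverse I G] with x hx
    simp [hx]
  intro g
  have h2 : ContMDiffAt I 𝓘(ℝ, E →L[ℝ] E) ∞ (fun x : G => adjointCLM I (g⁻¹ * x)) g := by
    refine ContMDiffAt.comp g (g := fun x : G => adjointCLM I x) (by simpa using h1) ?_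
    exact contMDiffAt_const.mul contMDiffAt_id
  refine (contMDiffAt_const (c := adjointCLM I g)|>.clm_comp h2).congr_of_eventuallyEq
    (Eventually.of_forall fun x => ?_)
  simp [← adjointCLM_mul]

theorem continuous_adjointCLM : Continuous (fun g : G => adjointCLM I g) :=
  contMDiff_adjointCLM.continuous

end Boundaryless

end ChartCalculus

section LogDeriv

variable {E : Type*} [NormedAddCommGroup E] [NormedSpace ℝ E]
  {H : Type*} [TopologicalSpace H] {I : ModelWithCorners ℝ E H}
  {G : Type*} [TopologicalSpace G] [ChartedSpace H G] [Group G]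

theorem HasLeftLogDerivAt.unique {γ : ℝ → G} {ξ η : E} {θ : ℝ} (h : HasLeftLogDerivAt I γ ξ θ)
    (h' : HasLeftLogDerivAt I γ η θ) : ξ = η := h.2.unique h'.2

theorem HasLeftLogDerivAt.congr_of_eventuallyEq {γ δ : ℝ → G} {ξ : E} {θ : ℝ}
    (h : HasLeftLogDerivAt I γ ξ θ) (e : δ =ᶠ[𝓝 θ] γ) : HasLeftLogDerivAt I δ ξ θ := by
  refine ⟨h.1.congr_of_eventuallyEq e, h.2.congr_of_eventuallyEq ?_⟩
  filter_upwards [e] with τ hτ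
  rw [hτ, e.eq_of_nhds]

theorem HasLeftLogDerivAt.comp_hasDerivAt {γ : ℝ → G} {ξ : E} {θ : ℝ} {f : ℝ → ℝ} {f' : ℝ}
    (h : HasLeftLogDerivAt I γ ξ (f θ)) (hf : HasDerivAt f f' θ) :
    HasLeftLogDerivAt I (fun τ => γ (f τ)) (f' • ξ) θ :=
  ⟨h.1.comp_of_eq hf.continuousAt rfl, HasDerivAt.scomp θ h.2 hf⟩

theorem hasLeftLogDerivAt_const (x : G) (θ : ℝ) : HasLeftLogDerivAt I (fun _ => x) 0 θ :=
  ⟨continuousAt_const, by simpa using hasDerivAt_const θ _⟩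

variable [LieGroup I ∞ G]

theorem HasLeftLogDerivAt.const_mul {γ : ℝ → G} {ξ : E} {θ : ℝ} (h : HasLeftLogDerivAt I γ ξ θ)
    (x : G) : HasLeftLogDerivAt I (fun τ => x * γ τ) ξ θ := by
  have := topologicalGroup_of_lieGroup I ∞ (G := G)
  exact ⟨continuousAt_const.mul h.1, by simpa [mul_assoc] using h.2⟩

theorem HasLeftLogDerivAt.continuousAt_div {γ : ℝ → G} {ξ : E} {θ : ℝ}
    (h : HasLeftLogDerivAt I γ ξ θ) : ContinuousAt (fun τ => (γ θ)⁻¹ * γ τ) θ := by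
  have := topologicalGroup_of_lieGroup I ∞ (G := G)
  exact continuousAt_const.mul h.1

variable [I.Boundaryless]

theorem HasLeftLogDerivAt.hasDerivAt_comp {V : Type*} [NormedAddCommGroup V] [NormedSpace ℝ V]
    {γ : ℝ → G} {ξ : E} {θ : ℝ} (h : HasLeftLogDerivAt I γ ξ θ) {f : G → V} {D : E →L[ℝ] V}
    (hf : HasFDerivAt (fun y => f ((unitChart I G).symm y)) D (unitCoord I G)) :
    HasDerivAt (fun τ => f ((γ θ)⁻¹ * γ τ)) (D ξ) θ :=
  hasDerivAt_comp_of_unitChart (by simp) hf h.continuousAt_div h.2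

theorem HasLeftLogDerivAt.mul {γ δ : ℝ → G} {ξ η : E} {θ : ℝ} (hγ : HasLeftLogDerivAt I γ ξ θ)
    (hδ : HasLeftLogDerivAt I δ η θ) :
    HasLeftLogDerivAt I (fun τ => γ τ * δ τ) (adjointCLM I (δ θ)⁻¹ ξ + η) θ := by
  have := topologicalGroup_of_lieGroup I ∞ (G := G)
  refine ⟨hγ.1.mul hδ.1, ?_⟩
  have h1 := hγ.hasDerivAt_comp
    (f := fun x => unitChart I G ((δ θ)⁻¹ * x * ((δ θ)⁻¹)⁻¹)) (hasFDerivAt_chartConj (I := I) (δ θ)⁻¹)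
  have h2 := h1.prodMk hδ.2
  have h3 := HasFDerivAt.comp_hasDerivAt θ
    (by simpa using hasFDerivAt_chartMul (I := I) (G := G)) h2
  simp only [add_apply, ContinuousLinearMap.coe_fst',
    ContinuousLinearMap.coe_snd'] at h3
  refine h3.congr_of_eventuallyEq ?_
  have c1 : ContinuousAt (fun τ => (δ θ)⁻¹ * ((γ θ)⁻¹ * γ τ) * ((δ θ)⁻¹)⁻¹) θ :=
    (continuousAt_const.mul hγ.continuousAt_div).mul continuousAt_const
  filter_upwards [c1.eventually (by simpa using eventually_symm_leftInverse I G),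
    hδ.continuousAt_div.eventually (by simpa using eventually_symm_leftInverse I G)] with τ e1 e2
  simp only [Function.comp_apply, e1, e2]
  congr 1
  group

theorem HasLeftLogDerivAt.mul_const {γ : ℝ → G} {ξ : E} {θ : ℝ} (h : HasLeftLogDerivAt I γ ξ θ)
    (x : G) : HasLeftLogDerivAt I (fun τ => γ τ * x) (adjointCLM I x⁻¹ ξ) θ := by
  simpa using h.mul (hasLeftLogDerivAt_const x θ)

theorem HasLeftLogDerivAt.inv {γ : ℝ → G} {ξ : E} {θ : ℝ} (h : HasLeftLogDerivAt I γ ξ θ) :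
    HasLeftLogDerivAt I (fun τ => (γ τ)⁻¹) (-adjointCLM I (γ θ) ξ) θ := by
  have := topologicalGroup_of_lieGroup I ∞ (G := G)
  refine ⟨h.1.inv, ?_⟩
  have h1 := h.hasDerivAt_comp
    (f := fun x => unitChart I G (γ θ * x * (γ θ)⁻¹)) (hasFDerivAt_chartConj (I := I) (γ θ))
  have h2 := HasFDerivAt.comp_hasDerivAt θ
    (by simpa using hasFDerivAt_chartInv (I := I) (G := G)) h1
  simp only [neg_apply, ContinuousLinearMap.id_apply] at h2
  refine h2.congr_of_eventuallyEq ?_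
  have c1 : ContinuousAt (fun τ => γ θ * ((γ θ)⁻¹ * γ τ) * (γ θ)⁻¹) θ :=
    (continuousAt_const.mul h.continuousAt_div).mul continuousAt_const
  filter_upwards [c1.eventually (by simpa using eventually_symm_leftInverse I G)] with τ e1
  simp only [Function.comp_apply, e1]
  congr 1
  group

theorem HasLeftLogDerivAt.adjointCLM {γ : ℝ → G} {ξ : E} {θ : ℝ} (h : HasLeftLogDerivAt I γ ξ θ) :
    HasDerivAt (fun τ => adjointCLM I (γ τ))
      ((adjointCLM I (γ θ)).comp (adjointDeriv I G ξ)) θ := by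
  have h1 := h.hasDerivAt_comp (hasFDerivAt_adjointCLM_symm (I := I) (G := G))
  have h2 := (hasDerivAt_const θ (_root_.adjointCLM I (γ θ))).clm_comp h1
  simpa [← adjointCLM_mul] using h2

theorem hasFDerivAt_adjointCLM_inv_symm :
    HasFDerivAt (fun y => adjointCLM I ((unitChart I G).symm y)⁻¹) (-adjointDeriv I G)
      (unitCoord I G) := by
  have := topologicalGroup_of_lieGroup I ∞ (G := G)
  have h := HasFDerivAt.comp (unitCoord I G)
    (by simpa using hasFDerivAt_adjointCLM_symm (I := I) (G := G))
    (hasFDerivAt_chartInv (I := I) (G := G))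
  have e : (adjointDeriv I G).comp (-ContinuousLinearMap.id ℝ E) = -adjointDeriv I G := by
    ext; simp
  rw [e] at h
  refine h.congr_of_eventuallyEq ?_
  have hcont : ContinuousAt (fun y : E => ((unitChart I G).symm y)⁻¹) (unitCoord I G) :=
    (contMDiffAt_unitChart_symm (unitCoord_mem_target I G)).inv.continuousAt
  filter_upwards [hcont.eventually (by simpa using eventually_symm_leftInverse I G)] with y hy
  simp [hy]

theorem HasLeftLogDerivAt.adjointCLM_inv {γ : ℝ → G} {ξ : E} {θ : ℝ}
    (h : HasLeftLogDerivAt I γ ξ θ) :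
    HasDerivAt (fun τ => _root_.adjointCLM I (γ τ)⁻¹)
      (-(adjointDeriv I G ξ).comp (_root_.adjointCLM I (γ θ)⁻¹)) θ := by
  have h1 := h.hasDerivAt_comp (f := fun x => _root_.adjointCLM I x⁻¹)
    (hasFDerivAt_adjointCLM_inv_symm (I := I) (G := G))
  have h2 := h1.clm_comp (hasDerivAt_const θ (_root_.adjointCLM I (γ θ)⁻¹))
  simp only [← adjointCLM_mul] at h2
  simpa using h2

/-! ### The left logarithmic derivative in the unit chart -/

theorem contDiffAt_leftTransDeriv_symm {y : E} (hy : y ∈ (unitChart I G).target) :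
    ContDiffAt ℝ ∞ (fun y => leftTransDeriv I ((unitChart I G).symm y)) y := by
  have h1 := contDiffAt_chartMul (I := I) hy (unitCoord_mem_target I G)
    (by simpa using (unitChart I G).map_target hy)
  exact ContDiffAt.fderiv (m := ∞) (x₀ := y) (g := fun _ => unitCoord I G)
    (f := fun y z => unitChart I G ((unitChart I G).symm y * (unitChart I G).symm z)) h1
    contDiffAt_const (by simp)

theorem contDiffAt_maurerCartanChart {y : E} (hy : y ∈ (unitChart I G).target) :
    ContDiffAt ℝ ∞ (maurerCartanChart I G) y := by
  have h1 := contDiffAt_chartLeftDiv (I := I) hy hy (by simp)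
  exact ContDiffAt.fderiv (m := ∞) (x₀ := y) (g := fun y => y)
    (f := fun y z => unitChart I G (((unitChart I G).symm y)⁻¹ * (unitChart I G).symm z)) h1
    contDiffAt_id (by simp)

theorem hasFDerivAt_leftTransDeriv {x : G} (hx : x ∈ (unitChart I G).source) :
    HasFDerivAt (fun z => unitChart I G (x * (unitChart I G).symm z)) (leftTransDeriv I x)
      (unitCoord I G) :=
  ((contDiffAt_unitChart_comp (contMDiffAt_const.mul
    (contMDiffAt_unitChart_symm (unitCoord_mem_target I G))) (by simpa using hx)).differentiableAt
      (by simp)).hasFDerivAt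

theorem hasFDerivAt_maurerCartanChart {y : E} (hy : y ∈ (unitChart I G).target) :
    HasFDerivAt (fun z => unitChart I G (((unitChart I G).symm y)⁻¹ * (unitChart I G).symm z))
      (maurerCartanChart I G y) y :=
  ((contDiffAt_unitChart_comp (contMDiffAt_const.mul
    (contMDiffAt_unitChart_symm hy)) (by simp)).differentiableAt (by simp)).hasFDerivAt

theorem HasLeftLogDerivAt.hasDerivAt_unitChart {γ : ℝ → G} {ξ : E} {θ : ℝ}
    (h : HasLeftLogDerivAt I γ ξ θ) (hθ : γ θ ∈ (unitChart I G).source) :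
    HasDerivAt (fun τ => unitChart I G (γ τ)) (leftTransDeriv I (γ θ) ξ) θ := by
  simpa using h.hasDerivAt_comp (f := fun x => unitChart I G (γ θ * x))
    (hasFDerivAt_leftTransDeriv hθ)

theorem hasLeftLogDerivAt_symm_comp {y : ℝ → E} {η : E} {θ : ℝ} (h : HasDerivAt y η θ)
    (hθ : y θ ∈ (unitChart I G).target) :
    HasLeftLogDerivAt I (fun τ => (unitChart I G).symm (y τ)) (maurerCartanChart I G (y θ) η) θ :=
  ⟨(contMDiffAt_unitChart_symm hθ).continuousAt.comp_of_eq h.continuousAt rfl,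
    HasFDerivAt.comp_hasDerivAt θ (hasFDerivAt_maurerCartanChart hθ) h⟩

theorem maurerCartanChart_leftTransDeriv {y : E} (hy : y ∈ (unitChart I G).target) (ξ : E) :
    maurerCartanChart I G y (leftTransDeriv I ((unitChart I G).symm y) ξ) = ξ := by
  have := topologicalGroup_of_lieGroup I ∞ (G := G)
  have h1 := hasFDerivAt_leftTransDeriv ((unitChart I G).map_target hy)
  have h2 := HasFDerivAt.comp (unitCoord I G)
    (by simpa [(unitChart I G).right_inv hy] using hasFDerivAt_maurerCartanChart (I := I) hy) h1
  have h3 := h2.unique ((hasFDerivAt_id _).congr_of_eventuallyEq (by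
    have hc : ContinuousAt (fun z => (unitChart I G).symm y * (unitChart I G).symm z)
        (unitCoord I G) := continuousAt_const.mul
          (contMDiffAt_unitChart_symm (unitCoord_mem_target I G)).continuousAt
    have h4 := hc.eventually ((isOpen_unitChart_source I G).mem_nhds (by
      simpa using (unitChart I G).map_target hy))
    filter_upwards [h4, eventually_symm_rightInverse I G] with z hz hz'
    simp [(unitChart I G).left_inv hz, hz']))
  exact DFunLike.congr_fun h3 ξ

end LogDeriv

section Existence

variable {E : Type*} [NormedAddCommGroup E] [NormedSpace ℝ E]
  {H : Type*} [TopologicalSpace H] {I : ModelWithCorners ℝ E H}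
  {G : Type*} [TopologicalSpace G] [ChartedSpace H G] [Group G]
  [LieGroup I ∞ G] [I.Boundaryless]

/-! ### Uniqueness -/

theorem eventually_eq_of_hasLeftLogDerivAt_zero {γ : ℝ → G} {θ₀ : ℝ}
    (h : ∀ᶠ θ in 𝓝 θ₀, HasLeftLogDerivAt I γ 0 θ) : ∀ᶠ θ in 𝓝 θ₀, γ θ = γ θ₀ := by
  have hδ : ∀ᶠ θ in 𝓝 θ₀, HasLeftLogDerivAt I (fun τ => (γ θ₀)⁻¹ * γ τ) 0 θ :=
    h.mono fun θ hθ => hθ.const_mul _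
  have hs : ∀ᶠ θ in 𝓝 θ₀, (γ θ₀)⁻¹ * γ θ ∈ (unitChart I G).source :=
    h.self_of_nhds.continuousAt_div.eventually
      ((isOpen_unitChart_source I G).mem_nhds (by simp))
  obtain ⟨ε, hε, hb⟩ := Metric.eventually_nhds_iff_ball.1 (hδ.and hs)
  filter_upwards [Metric.ball_mem_nhds θ₀ hε] with θ hθ
  have hd : ∀ τ ∈ Metric.ball θ₀ ε,
      HasDerivAt (fun τ => unitChart I G ((γ θ₀)⁻¹ * γ τ)) 0 τ := fun τ hτ => by
    simpa using (hb τ hτ).1.hasDerivAt_unitChart (hb τ hτ).2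
  have he := Metric.isOpen_ball.is_const_of_deriv_eq_zero (convex_ball θ₀ ε).isPreconnected
    (fun τ hτ => (hd τ hτ).differentiableAt.differentiableWithinAt)
    (fun τ hτ => (hd τ hτ).deriv) hθ (Metric.mem_ball_self hε)
  have he' := (unitChart I G).injOn (hb θ hθ).2 (hb θ₀ (Metric.mem_ball_self hε)).2 he
  exact mul_left_cancel he'

theorem eq_of_hasLeftLogDerivAt_zero {γ : ℝ → G} {S : Set ℝ} (hS : IsOpen S)
    (hp : IsPreconnected S) (h : ∀ θ ∈ S, HasLeftLogDerivAt I γ 0 θ) {a b : ℝ} (ha : a ∈ S)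
    (hb : b ∈ S) : γ a = γ b := by
  have : PreconnectedSpace S := Subtype.preconnectedSpace hp
  have hl : IsLocallyConstant (fun x : S => γ x) := by
    rw [IsLocallyConstant.iff_eventually_eq]
    intro x
    have := eventually_eq_of_hasLeftLogDerivAt_zero (I := I) (γ := γ) (θ₀ := x)
      (by filter_upwards [hS.mem_nhds x.2] with θ hθ using h θ hθ)
    exact continuous_subtype_val.continuousAt.eventually this
  exact hl.apply_eq_of_preconnectedSpace ⟨a, ha⟩ ⟨b, hb⟩

/-- Curves in a Lie group with the same left logarithmic derivative differ by a left translation. -/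
theorem eqOn_of_hasLeftLogDerivAt {γ δ : ℝ → G} {c : ℝ → E} {S : Set ℝ} (hS : IsOpen S)
    (hp : IsPreconnected S) (hγ : ∀ θ ∈ S, HasLeftLogDerivAt I γ (c θ) θ)
    (hδ : ∀ θ ∈ S, HasLeftLogDerivAt I δ (c θ) θ) {a : ℝ} (ha : a ∈ S) (e : γ a = δ a) :
    EqOn γ δ S := by
  intro b hb
  have h0 : ∀ θ ∈ S, HasLeftLogDerivAt I (fun τ => γ τ * (δ τ)⁻¹) 0 θ := fun θ hθ => by
    simpa using (hγ θ hθ).mul (hδ θ hθ).inv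
  have := eq_of_hasLeftLogDerivAt_zero hS hp h0 ha hb
  simp only [e, mul_inv_cancel] at this
  exact (mul_inv_eq_one.1 this.symm)

theorem eq_of_hasLeftLogDerivAt {γ δ : ℝ → G} {c : ℝ → E}
    (hγ : ∀ θ, HasLeftLogDerivAt I γ (c θ) θ) (hδ : ∀ θ, HasLeftLogDerivAt I δ (c θ) θ) {a : ℝ}
    (e : γ a = δ a) : γ = δ :=
  funext fun b => eqOn_of_hasLeftLogDerivAt isOpen_univ isPreconnected_univ (fun θ _ => hγ θ)
    (fun θ _ => hδ θ) (mem_univ a) e (mem_univ b)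

/-! ### Existence -/

theorem exists_local_hasLeftLogDerivAt [CompleteSpace E] {c : ℝ → E} {θ₀ : ℝ}
    (hc : ContDiffAt ℝ 1 c θ₀) :
    ∃ γ : ℝ → G, γ θ₀ = 1 ∧ ∀ᶠ θ in 𝓝 θ₀, HasLeftLogDerivAt I γ (c θ) θ := by
  have hf : ContDiffAt ℝ 1
      (fun p : ℝ × E => ((1 : ℝ), leftTransDeriv I ((unitChart I G).symm p.2) (c p.1)))
      (θ₀, unitCoord I G) := by
    refine contDiffAt_const.prodMk (ContDiffAt.clm_apply ?_ ?_)
    · have h := (contDiffAt_leftTransDeriv_symm (I := I) (unitCoord_mem_target I G)).comp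
        (θ₀, unitCoord I G) contDiffAt_snd
      exact h.of_le (mod_cast le_top)
    · exact hc.comp (θ₀, unitCoord I G) contDiffAt_fst
  obtain ⟨r, hr, ε, hε, hα⟩ :=
    hf.exists_forall_mem_closedBall_exists_eq_forall_mem_Ioo_hasDerivAt θ₀
  obtain ⟨α, hα0, hα⟩ := hα _ (Metric.mem_closedBall_self hr.le)
  have h1 : ∀ t ∈ Ioo (θ₀ - ε) (θ₀ + ε), (α t).1 = t := by
    intro t ht
    have hd : ∀ s ∈ Ioo (θ₀ - ε) (θ₀ + ε), HasDerivAt (fun s => (α s).1 - s) 0 s := fun s hs => by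
      have h : HasDerivAt (fun s => (α s).1 - s) ((1 : ℝ) - 1) s :=
        HasDerivAt.sub (HasFDerivAt.comp_hasDerivAt (f := α) (l := Prod.fst)
          (l' := ContinuousLinearMap.fst ℝ ℝ E) s hasFDerivAt_fst (hα s hs)) (hasDerivAt_id s)
      rwa [sub_self] at h
    have := isOpen_Ioo.is_const_of_deriv_eq_zero isPreconnected_Ioo
      (fun s hs => (hd s hs).differentiableAt.differentiableWithinAt)
      (fun s hs => (hd s hs).deriv) ht (y := θ₀) ⟨by linarith, by linarith⟩
    simp only [hα0, sub_self] at this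
    linarith
  have hmem : ∀ᶠ t in 𝓝 θ₀, t ∈ Ioo (θ₀ - ε) (θ₀ + ε) := Ioo_mem_nhds (by linarith) (by linarith)
  have hcont : ContinuousAt (fun t => (α t).2) θ₀ :=
    continuousAt_snd.comp (hα θ₀ ⟨by linarith, by linarith⟩).continuousAt
  refine ⟨fun t => (unitChart I G).symm (α t).2, by simp [hα0], ?_⟩
  filter_upwards [hmem, hcont.eventually_mem (by
    rw [hα0]; exact unitChart_target_mem_nhds I G)] with t ht hy
  have hd := (hasFDerivAt_snd (𝕜 := ℝ)).comp_hasDerivAt t (hα t ht)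
  have := hasLeftLogDerivAt_symm_comp (I := I) (G := G) hd hy
  simp only [ContinuousLinearMap.coe_snd', Function.comp_apply] at this
  rwa [maurerCartanChart_leftTransDeriv hy, h1 t ht] at this

theorem exists_hasLeftLogDerivAt_glue {γ δ : ℝ → G} {c : ℝ → E} {a b d : ℝ}
    (hγ : ∀ θ ∈ Icc a b, HasLeftLogDerivAt I γ (c θ) θ)
    (hδ : ∀ θ ∈ Icc b d, HasLeftLogDerivAt I δ (c θ) θ) :
    ∃ η : ℝ → G, ∀ θ ∈ Icc a d, HasLeftLogDerivAt I η (c θ) θ := by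
  have := topologicalGroup_of_lieGroup I ∞ (G := G)
  set δ' : ℝ → G := fun τ => γ b * (δ b)⁻¹ * δ τ with hδ'
  have hδ₁ : ∀ θ ∈ Icc b d, HasLeftLogDerivAt I δ' (c θ) θ := fun θ hθ => (hδ θ hθ).const_mul _
  have hb : δ' b = γ b := by simp [hδ']
  refine ⟨fun τ => if τ ≤ b then γ τ else δ' τ, fun θ hθ => ?_⟩
  rcases lt_trichotomy θ b with h | h | h
  · refine (hγ θ ⟨hθ.1, h.le⟩).congr_of_eventuallyEq ?_
    filter_upwards [Iio_mem_nhds h] with τ hτ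
    exact if_pos (le_of_lt hτ)
  · subst h
    have h1 := hγ θ ⟨hθ.1, le_rfl⟩
    have h2 := hδ₁ θ ⟨le_rfl, hθ.2⟩
    have e1 : ∀ τ ∈ Iic θ, (if τ ≤ θ then γ τ else δ' τ) = γ τ := fun τ hτ => if_pos hτ
    have e2 : ∀ τ ∈ Ici θ, (if τ ≤ θ then γ τ else δ' τ) = δ' τ := fun τ hτ => by
      rcases eq_or_lt_of_le (mem_Ici.1 hτ) with h | h
      · subst h; simp [hb]
      · exact if_neg (not_le.2 h)
    refine ⟨?_, ?_⟩
    · rw [← continuousWithinAt_univ, ← Iic_union_Ici (a := θ)]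
      exact (h1.1.continuousWithinAt.congr e1 (e1 θ self_mem_Iic)).union
        (h2.1.continuousWithinAt.congr e2 (e2 θ self_mem_Ici))
    · rw [← hasDerivWithinAt_univ, ← Iic_union_Ici (a := θ)]
      refine HasDerivWithinAt.union ?_ ?_
      · refine h1.2.hasDerivWithinAt.congr (fun τ hτ => ?_) ?_
        · simp only [e1 τ hτ, e1 θ self_mem_Iic]
        · simp only [e1 θ self_mem_Iic]
      · refine h2.2.hasDerivWithinAt.congr (fun τ hτ => ?_) ?_
        · simp only [e2 τ hτ, e2 θ self_mem_Ici]
        · simp only [e2 θ self_mem_Ici]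
  · refine (hδ₁ θ ⟨h.le, hθ.2⟩).congr_of_eventuallyEq ?_
    filter_upwards [Ioi_mem_nhds h] with τ hτ
    exact if_neg (not_le.2 hτ)

theorem exists_hasLeftLogDerivAt_Icc [CompleteSpace E] {c : ℝ → E} (hc : ContDiff ℝ 1 c)
    (a b : ℝ) : ∃ γ : ℝ → G, ∀ θ ∈ Icc a b, HasLeftLogDerivAt I γ (c θ) θ := by
  rcases lt_or_ge b a with hab | hab
  · exact ⟨1, by simp [Icc_eq_empty hab.not_ge]⟩
  choose γ hγ0 hγ using fun θ₀ : Icc a b =>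
    exists_local_hasLeftLogDerivAt (I := I) (G := G) (hc.contDiffAt (x := (θ₀ : ℝ)))
  choose U hU hUo hUm using fun θ₀ : Icc a b => eventually_nhds_iff.1 (hγ θ₀)
  obtain ⟨t, ht0, htm, ⟨m, hm⟩, ht⟩ := exists_monotone_Icc_subset_open_cover_Icc hab
    (c := fun θ₀ : Icc a b => Subtype.val ⁻¹' (U θ₀))
    (fun θ₀ => (hUo θ₀).preimage continuous_subtype_val)
    (fun θ _ => mem_iUnion.2 ⟨θ, hUm θ⟩)
  have key : ∀ n, ∃ η : ℝ → G, ∀ θ ∈ Icc a (t n), HasLeftLogDerivAt I η (c θ) θ := by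
    intro n
    induction n with
    | zero =>
      refine ⟨γ ⟨a, le_rfl, hab⟩, fun θ hθ => ?_⟩
      rw [ht0, Icc_self, mem_singleton_iff] at hθ
      subst hθ
      exact (hγ ⟨θ, le_rfl, hab⟩).self_of_nhds
    | succ n ih =>
      obtain ⟨η, hη⟩ := ih
      obtain ⟨i, hi⟩ := ht n
      refine exists_hasLeftLogDerivAt_glue hη (δ := γ i) fun θ hθ => hU i θ ?_
      have hmem : θ ∈ Icc a b := ⟨(t n).2.1.trans hθ.1, hθ.2.trans (t (n + 1)).2.2⟩
      exact hi (show (⟨θ, hmem⟩ : Icc a b) ∈ Icc (t n) (t (n + 1)) from ⟨hθ.1, hθ.2⟩)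
  obtain ⟨η, hη⟩ := key m
  exact ⟨η, by rwa [hm m le_rfl] at hη⟩

/-- A curve in the Lie algebra is the left logarithmic derivative of a curve in the group. -/
theorem exists_hasLeftLogDerivAt [CompleteSpace E] {c : ℝ → E} (hc : ContDiff ℝ 1 c) :
    ∃ γ : ℝ → G, γ 0 = 1 ∧ ∀ θ, HasLeftLogDerivAt I γ (c θ) θ := by
  have h : ∀ n : ℕ, ∃ γ : ℝ → G, γ 0 = 1 ∧
      ∀ θ ∈ Ioo (-(n : ℝ)) n, HasLeftLogDerivAt I γ (c θ) θ := fun n => by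
    obtain ⟨γ, hγ⟩ := exists_hasLeftLogDerivAt_Icc (I := I) (G := G) hc (-(n : ℝ)) n
    exact ⟨fun τ => (γ 0)⁻¹ * γ τ, by simp, fun θ hθ => (hγ θ (Ioo_subset_Icc_self hθ)).const_mul _⟩
  choose γ hγ0 hγ using h
  have hcompat : ∀ m n : ℕ, 0 < m → m ≤ n → EqOn (γ n) (γ m) (Ioo (-(m : ℝ)) m) := by
    intro m n hm hmn
    have hm' : (0 : ℝ) < m := by exact_mod_cast hm
    have hmn' : (m : ℝ) ≤ n := by exact_mod_cast hmn
    exact eqOn_of_hasLeftLogDerivAt isOpen_Ioo isPreconnected_Ioo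
      (fun θ hθ => hγ n θ ⟨by linarith [hθ.1], by linarith [hθ.2]⟩) (hγ m)
      (a := 0) ⟨by linarith, hm'⟩ (by rw [hγ0, hγ0])
  refine ⟨fun τ => γ (⌊|τ|⌋₊ + 1) τ, by simp [hγ0], fun θ => ?_⟩
  set N := ⌊|θ|⌋₊ + 2
  have hN : |θ| + 1 < N := by
    have := Nat.lt_floor_add_one |θ|
    push_cast [N]; linarith
  have hθN := abs_lt.1 (show |θ| < N by linarith)
  refine (hγ N θ ⟨hθN.1, hθN.2⟩).congr_of_eventuallyEq ?_
  filter_upwards [Metric.ball_mem_nhds θ one_pos] with τ hτ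
  have hτ1 : |τ| ≤ |θ| + 1 := by
    rw [Metric.mem_ball, Real.dist_eq] at hτ
    have := abs_sub_abs_le_abs_sub τ θ
    linarith
  have hle : ⌊|τ|⌋₊ + 1 ≤ N := by
    have : ⌊|τ|⌋₊ < N := (Nat.floor_lt (abs_nonneg _)).2 (by linarith)
    omega
  have := abs_lt.1 (Nat.lt_floor_add_one |τ|)
  refine (hcompat _ _ (Nat.succ_pos _) hle ?_).symm
  push_cast
  exact this

/-! ### Smoothness -/

theorem contMDiff_of_hasLeftLogDerivAt [CompleteSpace E] {γ : ℝ → G} {c : ℝ → E}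
    (hc : ContDiff ℝ ∞ c) (h : ∀ θ, HasLeftLogDerivAt I γ (c θ) θ) :
    ContMDiff 𝓘(ℝ, ℝ) I ∞ γ := by
  intro θ₀
  have hδ : ∀ θ, HasLeftLogDerivAt I (fun τ => (γ θ₀)⁻¹ * γ τ) (c θ) θ :=
    fun θ => (h θ).const_mul _
  have hs : ∀ᶠ θ in 𝓝 θ₀, (γ θ₀)⁻¹ * γ θ ∈ (unitChart I G).source :=
    (h θ₀).continuousAt_div.eventually ((isOpen_unitChart_source I G).mem_nhds (by simp))
  obtain ⟨ε, hε, hb⟩ := Metric.nhds_basis_closedBall.eventually_iff.1 hs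
  rw [Real.closedBall_eq_Icc] at hb
  set y : ℝ → E := fun τ => unitChart I G ((γ θ₀)⁻¹ * γ τ) with hy
  have hinv : ∀ τ ∈ Icc (θ₀ - ε) (θ₀ + ε), (unitChart I G).symm (y τ) = (γ θ₀)⁻¹ * γ τ :=
    fun τ hτ => (unitChart I G).left_inv (hb hτ)
  have hcd : ContDiffOn ℝ ∞ y (Icc (θ₀ - ε) (θ₀ + ε)) := by
    refine ODE.contDiffOn_enat_Icc_of_hasDerivWithinAt (n := ⊤) (u := (unitChart I G).target)
      (f := fun τ z => leftTransDeriv I ((unitChart I G).symm z) (c τ)) ?_ ?_ ?_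
    · rintro ⟨τ, z⟩ ⟨-, hz⟩
      refine ContDiffAt.contDiffWithinAt (ContDiffAt.clm_apply ?_ ?_)
      · exact (contDiffAt_leftTransDeriv_symm hz).comp (τ, z) contDiffAt_snd
      · exact hc.contDiffAt.comp (τ, z) contDiffAt_fst
    · intro τ hτ
      rw [hinv τ hτ]
      exact ((hδ τ).hasDerivAt_unitChart (hb hτ)).hasDerivWithinAt
    · exact fun τ hτ => (unitChart I G).map_source (hb hτ)
  have hnhds : Icc (θ₀ - ε) (θ₀ + ε) ∈ 𝓝 θ₀ := Icc_mem_nhds (by linarith) (by linarith)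
  have h1 : ContMDiffAt 𝓘(ℝ, ℝ) I ∞ (fun τ => (unitChart I G).symm (y τ)) θ₀ :=
    ContMDiffAt.comp θ₀ (contMDiffAt_unitChart_symm ((unitChart I G).map_source
      (hs.self_of_nhds))) (hcd.contDiffAt hnhds).contMDiffAt
  have h2 : ContMDiffAt 𝓘(ℝ, ℝ) I ∞ (fun τ => γ θ₀ * (unitChart I G).symm (y τ)) θ₀ :=
    contMDiffAt_const.mul h1
  refine h2.congr_of_eventuallyEq ?_
  filter_upwards [hnhds] with τ hτ
  simp [hinv τ hτ]

theorem hasLeftLogDerivAt_of_contMDiffAt {γ : ℝ → G} {θ : ℝ}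
    (h : MDifferentiableAt 𝓘(ℝ, ℝ) I γ θ) :
    HasLeftLogDerivAt I γ
      (mfderiv 𝓘(ℝ, ℝ) I (fun τ : ℝ => (γ θ)⁻¹ * γ τ) θ (1 : ℝ) : E) θ := by
  have hd : MDifferentiableAt 𝓘(ℝ, ℝ) I (fun τ : ℝ => (γ θ)⁻¹ * γ τ) θ := by
    have h1 : MDifferentiableAt I I (fun x => (γ θ)⁻¹ * x) (γ θ) :=
      (contMDiff_const.mul contMDiff_id : ContMDiff I I ∞ fun x => (γ θ)⁻¹ * x).mdifferentiableAt
        (by simp)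
    exact h1.comp θ h
  refine ⟨h.continuousAt, ?_⟩
  have h1 := hd.hasMFDerivAt.2
  simp only [writtenInExtChartAt, inv_mul_cancel, modelWithCornersSelf_coe, range_id] at h1
  exact HasFDerivAt.hasDerivAt (hasFDerivWithinAt_univ.1 h1)

/-- The left logarithmic derivative of a smooth curve is smooth. -/
theorem contDiff_of_hasLeftLogDerivAt {γ : ℝ → G} {c : ℝ → E}
    (hγ : ContMDiff 𝓘(ℝ, ℝ) I ∞ γ) (h : ∀ θ, HasLeftLogDerivAt I γ (c θ) θ) :
    ContDiff ℝ ∞ c := by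
  rw [contDiff_iff_contDiffAt]
  intro θ₀
  set δ : ℝ → G := fun τ => (γ θ₀)⁻¹ * γ τ with hδdef
  have hδ : ∀ θ, HasLeftLogDerivAt I δ (c θ) θ := fun θ => (h θ).const_mul _
  have hδs : ContMDiff 𝓘(ℝ, ℝ) I ∞ δ := contMDiff_const.mul hγ
  have hs : ∀ᶠ θ in 𝓝 θ₀, δ θ ∈ (unitChart I G).source :=
    (h θ₀).continuousAt_div.eventually ((isOpen_unitChart_source I G).mem_nhds (by simp))
  have hy : ContDiffAt ℝ ∞ (fun τ => unitChart I G (δ τ)) θ₀ :=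
    contDiffAt_unitChart_comp hδs.contMDiffAt hs.self_of_nhds
  have hm : ContDiffAt ℝ ∞ (fun τ => maurerCartanChart I G (unitChart I G (δ τ))
      (deriv (fun τ => unitChart I G (δ τ)) τ)) θ₀ := by
    refine ContDiffAt.clm_apply ?_ ?_
    · exact (contDiffAt_maurerCartanChart
        ((unitChart I G).map_source hs.self_of_nhds)).comp θ₀ hy
    · exact (hy.fderiv_right (m := ∞) (by simp)).clm_apply contDiffAt_const
  refine hm.congr_of_eventuallyEq ?_
  filter_upwards [hs] with θ hθ
  rw [((hδ θ).hasDerivAt_unitChart hθ).deriv]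
  have := maurerCartanChart_leftTransDeriv ((unitChart I G).map_source hθ) (c θ)
  rw [(unitChart I G).left_inv hθ] at this
  exact this.symm

end Existence

section ContinuousDependence

variable {E : Type*} [NormedAddCommGroup E] [NormedSpace ℝ E] [FiniteDimensional ℝ E]
  {H : Type*} [TopologicalSpace H] {I : ModelWithCorners ℝ E H}
  {G : Type*} [TopologicalSpace G] [ChartedSpace H G] [Group G]
  [LieGroup I ∞ G] [I.Boundaryless] [T2Space G]

/-- A curve which starts at the identity stays close to it as long as its left logarithmic
derivative is small. -/
theorem exists_forall_mem_of_norm_leftLogDeriv_le {U : Set G} (hU : U ∈ 𝓝 (1 : G)) {T : ℝ}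
    (hT : 0 ≤ T) : ∃ δ > 0, ∀ (γ : ℝ → G) (c : ℝ → E), γ 0 = 1 →
      (∀ θ ∈ Icc 0 T, HasLeftLogDerivAt I γ (c θ) θ) → (∀ θ ∈ Icc 0 T, ‖c θ‖ ≤ δ) →
      ∀ θ ∈ Icc 0 T, γ θ ∈ U := by
  set o := unitCoord I G
  set φ := unitChart I G
  have hcont := (contDiffAt_leftTransDeriv_symm (unitCoord_mem_target I G)).continuousAt
  set C : ℝ := ‖leftTransDeriv I (φ.symm o)‖ + 1
  have hC : 0 < C := by positivity
  have hev : ∀ᶠ y in 𝓝 o, (‖leftTransDeriv I (φ.symm y)‖ < C ∧ φ.symm y ∈ U) ∧ y ∈ φ.target := by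
    refine ((hcont.norm.eventually (gt_mem_nhds (lt_add_one _))).and ?_).and
      (unitChart_target_mem_nhds I G)
    exact (contMDiffAt_unitChart_symm (unitCoord_mem_target I G)).continuousAt.eventually_mem
      (by simpa using hU)
  obtain ⟨r, hr, hb⟩ := Metric.nhds_basis_closedBall.eventually_iff.1 hev
  set V : Set G := φ.symm '' Metric.closedBall o r
  have hVc : IsClosed V := by
    refine ((isCompact_closedBall o r).image_of_continuousOn fun y hy => ?_).isClosed
    exact (contMDiffAt_unitChart_symm (hb hy).2).continuousAt.continuousWithinAt
  have hVs : ∀ x ∈ V, x ∈ φ.source ∧ φ x ∈ Metric.closedBall o r ∧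
      ‖leftTransDeriv I x‖ ≤ C ∧ x ∈ U := by
    rintro _ ⟨y, hy, rfl⟩
    refine ⟨φ.map_target (hb hy).2, ?_, (hb hy).1.1.le, (hb hy).1.2⟩
    rwa [φ.right_inv (hb hy).2]
  have hsV : ∀ x ∈ φ.source, φ x ∈ Metric.closedBall o r → x ∈ V :=
    fun x hx hy => ⟨φ x, hy, φ.left_inv hx⟩
  refine ⟨r / (C * (T + 1)), by positivity, fun γ c h0 hγ hc => ?_⟩
  set δ := r / (C * (T + 1))
  have hδ : C * δ * T < r := by
    have : C * δ * (T + 1) = r := by simp only [δ]; field_simp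
    have : 0 < C * δ := by positivity
    linarith
  have hγc : ContinuousOn γ (Icc 0 T) := fun θ hθ => (hγ θ hθ).1.continuousWithinAt
  have hK : IsClosed (Icc 0 T ∩ γ ⁻¹' V) := hγc.preimage_isClosed_of_isClosed isClosed_Icc hVc
  have hd : ∀ θ ∈ Icc 0 T ∩ γ ⁻¹' V,
      HasDerivAt (fun τ => φ (γ τ)) (leftTransDeriv I (γ θ) (c θ)) θ :=
    fun θ hθ => (hγ θ hθ.1).hasDerivAt_unitChart (hVs _ hθ.2).1
  have hdn : ∀ θ ∈ Icc 0 T ∩ γ ⁻¹' V, ‖leftTransDeriv I (γ θ) (c θ)‖ ≤ C * δ := fun θ hθ =>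
    ((leftTransDeriv I (γ θ)).le_opNorm _).trans
      (mul_le_mul (hVs _ hθ.2).2.2.1 (hc θ hθ.1) (norm_nonneg _) hC.le)
  set s : Set ℝ := {θ | γ θ ∈ V ∧ ‖φ (γ θ) - o‖ ≤ C * δ * θ}
  have hs : Icc 0 T ⊆ s := by
    refine IsClosed.Icc_subset_of_forall_exists_gt ?_ ?_ ?_
    · have : s ∩ Icc 0 T = (Icc 0 T ∩ γ ⁻¹' V) ∩
          (fun θ => C * δ * θ - ‖φ (γ θ) - o‖) ⁻¹' Ici 0 := by
        ext θ
        simp only [s, mem_inter_iff, mem_ofPred_eq, mem_preimage, mem_Ici, sub_nonneg]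
        tauto
      rw [this]
      refine ContinuousOn.preimage_isClosed_of_isClosed (fun θ hθ => ?_) hK isClosed_Ici
      refine ContinuousAt.continuousWithinAt ?_
      exact (continuousAt_const.mul continuousAt_id).sub
        ((hd θ hθ).continuousAt.sub continuousAt_const).norm
    · have h1 : φ 1 = o := rfl
      refine ⟨?_, by simp [h0, h1]⟩
      rw [h0]
      exact hsV 1 (mem_unitChart_source_one I G) (Metric.mem_closedBall_self hr.le)
    · rintro θ ⟨⟨hθV, hθ⟩, hθ0, hθT⟩ θ' hθ'
      have hθI : θ ∈ Icc 0 T := ⟨hθ0, hθT.le⟩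
      have hlt : ‖φ (γ θ) - o‖ < r :=
        hθ.trans_lt (lt_of_le_of_lt (by gcongr) hδ)
      have hev : ∀ᶠ τ in 𝓝 θ, γ τ ∈ V := by
        filter_upwards [(hγ θ hθI).1.eventually_mem
          ((isOpen_unitChart_source I G).mem_nhds (hVs _ hθV).1),
          (hd θ ⟨hθI, hθV⟩).continuousAt.eventually_mem
            (Metric.isOpen_ball.mem_nhds (by simpa [dist_eq_norm] using hlt))] with τ h1 h2
        exact hsV _ h1 (Metric.ball_subset_closedBall h2)
      obtain ⟨ε, hε, hεb⟩ := Metric.eventually_nhds_iff_ball.1 hev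
      set τ := min (min θ' T) (θ + ε / 2)
      have hθτ : θ < τ := lt_min (lt_min hθ' hθT) (by linarith)
      have hτI : ∀ x ∈ Icc θ τ, x ∈ Icc 0 T ∩ γ ⁻¹' V := fun x hx => by
        have h1 := hx.2.trans (min_le_right _ _)
        have h2 := hx.2.trans ((min_le_left _ _).trans (min_le_right _ _))
        refine ⟨⟨hθ0.trans hx.1, h2⟩, hεb x ?_⟩
        rw [Metric.mem_ball, Real.dist_eq, abs_of_nonneg (by linarith [hx.1])]
        linarith
      have hest := norm_image_sub_le_of_norm_deriv_le_segment'
        (fun x hx => (hd x (hτI x hx)).hasDerivWithinAt)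
        (fun x hx => hdn x (hτI x (Ico_subset_Icc_self hx))) τ ⟨hθτ.le, le_rfl⟩
      refine ⟨τ, ⟨(hτI τ ⟨hθτ.le, le_rfl⟩).2, ?_⟩, hθτ, (min_le_left _ _).trans (min_le_left _ _)⟩
      calc ‖φ (γ τ) - o‖ = ‖(φ (γ τ) - φ (γ θ)) + (φ (γ θ) - o)‖ := by congr 1; abel
        _ ≤ C * δ * (τ - θ) + C * δ * θ := (norm_add_le _ _).trans (add_le_add hest hθ)
        _ = C * δ * τ := by ring
  exact fun θ hθ => (hVs _ (hs hθ).1).2.2.2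

/-- The curve with a given left logarithmic derivative depends continuously on it. -/
theorem continuous_uncurry_of_hasLeftLogDerivAt {X : Type*} [TopologicalSpace X] {c : X → ℝ → E}
    (hc : Continuous fun p : X × ℝ => c p.1 p.2) {γ : X → ℝ → G} (h0 : ∀ x, γ x 0 = 1)
    (h : ∀ x θ, HasLeftLogDerivAt I (γ x) (c x θ) θ) :
    Continuous fun p : X × ℝ => γ p.1 p.2 := by
  have := topologicalGroup_of_lieGroup I ∞ (G := G)
  rw [continuous_iff_continuousAt]
  rintro ⟨x₀, θ₀⟩
  have hγ0 : Continuous (γ x₀) := continuous_iff_continuousAt.2 fun θ => (h x₀ θ).1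
  set d : X → ℝ → E := fun x τ => adjointCLM I (γ x₀ τ) (c x τ - c x₀ τ)
  have hd : Continuous fun p : X × ℝ => d p.1 p.2 :=
    (continuous_adjointCLM.comp (hγ0.comp continuous_snd)).clm_apply
      (hc.sub (hc.comp (continuous_const.prodMk continuous_snd)))
  set w : X → ℝ → G := fun x τ => γ x τ * (γ x₀ τ)⁻¹
  have hw : ∀ x θ, HasLeftLogDerivAt I (w x) (d x θ) θ := fun x θ => by
    simpa [d, sub_eq_add_neg] using (h x θ).mul (h x₀ θ).inv
  have hw0 : ∀ x, w x 0 = 1 := fun x => by simp [w, h0]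
  have hlim : Tendsto (fun p : X × ℝ => w p.1 p.2) (𝓝 (x₀, θ₀)) (𝓝 1) := by
    intro U hU
    set T := |θ₀| + 1
    obtain ⟨δ, hδ, hδU⟩ := exists_forall_mem_of_norm_leftLogDeriv_le (I := I) hU
      (T := T) (by positivity)
    have hev : ∀ᶠ x in 𝓝 x₀, ∀ τ ∈ Icc (-T) T, ‖d x τ‖ ≤ δ := by
      refine isCompact_Icc.eventually_forall_of_forall_eventually fun τ _ => ?_
      have : ‖d x₀ τ‖ < δ := by simpa [d] using hδ
      exact (hd.norm.continuousAt (x := (x₀, τ)).eventually (gt_mem_nhds this)).mono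
        fun p hp => le_of_lt hp
    have hθ : ∀ᶠ θ in 𝓝 θ₀, θ ∈ Icc (-T) T := by
      have := (continuous_abs.tendsto θ₀).eventually (gt_mem_nhds (lt_add_one |θ₀|))
      exact this.mono fun θ hθ => abs_le.1 (le_of_lt hθ)
    rw [mem_map]
    filter_upwards [(hev.prod_inl_nhds θ₀), (hθ.prod_inr_nhds x₀)] with p hp hpθ
    rcases le_total 0 p.2 with hs | hs
    · exact hδU (w p.1) (d p.1) (hw0 _) (fun θ _ => hw _ θ)
        (fun θ hθ => hp θ ⟨by linarith [hθ.1, hθ.2], hθ.2⟩) p.2 ⟨hs, hpθ.2⟩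
    · have := hδU (fun τ => w p.1 (-τ)) (fun τ => (-1 : ℝ) • d p.1 (-τ)) (by simp [hw0])
        (fun θ _ => (hw p.1 (-θ)).comp_hasDerivAt (hasDerivAt_neg θ))
        (fun θ hθ => by
          rw [neg_one_smul, norm_neg]
          exact hp (-θ) ⟨by linarith [hθ.2], by linarith [hθ.1, hθ.2]⟩)
        (-p.2) ⟨by linarith, by linarith [hpθ.1]⟩
      simpa using this
  have hlim2 := hlim.mul ((hγ0.comp continuous_snd).tendsto (x₀, θ₀) :
    Tendsto (fun p : X × ℝ => γ x₀ p.2) _ _)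
  simpa [w, ContinuousAt] using hlim2

end ContinuousDependence

/-! ### Curves on the circle -/

theorem contMDiff_circle_coe : ContMDiff (𝓡 1) 𝓘(ℝ, ℂ) ∞ (fun z : Circle => (z : ℂ)) := by
  have := finrank_real_complex_fact'
  exact contMDiff_coe_sphere

theorem hasDerivAt_coe_circleExp (θ : ℝ) :
    HasDerivAt (fun τ : ℝ => (Circle.exp τ : ℂ)) ((Circle.exp θ : ℂ) * Complex.I) θ := by
  simp only [Circle.coe_exp]
  have h : HasDerivAt (fun τ : ℝ => (τ : ℂ) * Complex.I) Complex.I θ := by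
    simpa using (Complex.ofRealCLM.hasDerivAt (x := θ)).mul_const Complex.I
  exact h.cexp

/-- The velocity of the curve `θ ↦ exp(iθ)` on the circle. -/
def circleVelocity (θ : ℝ) : EuclideanSpace ℝ (Fin 1) :=
  mfderiv 𝓘(ℝ, ℝ) (𝓡 1) Circle.exp θ (1 : ℝ)

theorem mdifferentiableAt_circleExp (θ : ℝ) :
    MDifferentiableAt 𝓘(ℝ, ℝ) (𝓡 1) Circle.exp θ :=
  (contMDiff_circleExp (m := 1)).mdifferentiableAt (by simp)

theorem mfderiv_circle_coe_circleVelocity (θ : ℝ) :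
    mfderiv (𝓡 1) 𝓘(ℝ, ℂ) (fun z : Circle => (z : ℂ)) (Circle.exp θ) (circleVelocity θ) =
      (Circle.exp θ : ℂ) * Complex.I := by
  have h1 := mfderiv_comp_apply (I := 𝓘(ℝ, ℝ)) (I' := 𝓡 1) (I'' := 𝓘(ℝ, ℂ)) θ
    (g := fun z : Circle => (z : ℂ)) (f := Circle.exp)
    (contMDiff_circle_coe.mdifferentiableAt (by simp)) (mdifferentiableAt_circleExp θ) (1 : ℝ)
  have h2 := (hasDerivAt_coe_circleExp θ).hasFDerivAt.hasMFDerivAt.mfderiv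
  refine h1.symm.trans ?_
  change mfderiv 𝓘(ℝ, ℝ) 𝓘(ℝ, ℂ) (fun τ : ℝ => (Circle.exp τ : ℂ)) θ (1 : ℝ) = _
  rw [h2]
  exact one_smul ℝ _

theorem circleVelocity_ne_zero (θ : ℝ) : circleVelocity θ ≠ 0 := by
  intro h
  have h1 := mfderiv_circle_coe_circleVelocity θ
  rw [h] at h1
  have h2 : (Circle.exp θ : ℂ) * Complex.I = 0 := h1.symm.trans (map_zero _)
  simp at h2

theorem exists_smul_circleVelocity (θ : ℝ) (a : EuclideanSpace ℝ (Fin 1)) :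
    ∃ s : ℝ, s • circleVelocity θ = a :=
  (finrank_eq_one_iff_of_nonzero' _ (circleVelocity_ne_zero θ)).1 (by simp) a

theorem circleExp_surjective : Function.Surjective Circle.exp := fun z => ⟨_, Circle.exp_arg z⟩

section Loops

variable {E : Type*} [NormedAddCommGroup E] [NormedSpace ℝ E]
  {H : Type*} [TopologicalSpace H] {I : ModelWithCorners ℝ E H}
  {M : Type*} [TopologicalSpace M] [ChartedSpace H M]

theorem apply_arg_circleExp {α : Type*} {γ : ℝ → α} (hp : Function.Periodic γ (2 * Real.pi))
    (θ : ℝ) : γ (Complex.arg (Circle.exp θ)) = γ θ := by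
  obtain ⟨m, hm⟩ := Circle.exp_eq_exp.1 (Circle.exp_arg (Circle.exp θ))
  rw [hm]
  exact (hp.int_mul m) θ

/-- A smooth periodic curve descends to the circle. -/
def loopOfPeriodic (γ : ℝ → M) (hγ : ContMDiff 𝓘(ℝ, ℝ) I ∞ γ)
    (hp : Function.Periodic γ (2 * Real.pi)) : C^∞⟮𝓡 1, Circle; I, M⟯ where
  val z := γ (Complex.arg z)
  property := by
    intro z₀
    have h1 : ContMDiffAt (𝓡 1) 𝓘(ℝ, ℝ) ∞
        (fun z : Circle => Complex.arg z₀ + (Complex.log ((z : ℂ) * (z₀⁻¹ : Circle))).im) z₀ := by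
      have hf : ContDiffAt ℝ ∞
          (fun w : ℂ => Complex.arg z₀ + (Complex.log (w * (z₀⁻¹ : Circle))).im) (z₀ : ℂ) := by
        refine contDiffAt_const.add ?_
        have hl : ContDiffAt ℝ ∞ Complex.log ((z₀ : ℂ) * (z₀⁻¹ : Circle)) := by
          rw [← Circle.coe_mul, mul_inv_cancel, Circle.coe_one]
          exact (Complex.contDiffAt_log (x := 1) (by simp) (n := ∞)).restrict_scalars ℝ
        have hl2 : ContDiffAt ℝ ∞ (fun w : ℂ => Complex.log (w * (z₀⁻¹ : Circle))) (z₀ : ℂ) :=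
          ContDiffAt.comp (z₀ : ℂ) (g := Complex.log) hl (contDiffAt_id.mul contDiffAt_const)
        exact (Complex.imCLM.contDiff (n := ∞)).contDiffAt.comp (z₀ : ℂ) hl2
      exact hf.contMDiffAt.comp z₀ contMDiff_circle_coe.contMDiffAt
    refine (hγ.contMDiffAt.comp z₀ h1).congr_of_eventuallyEq (Eventually.of_forall fun z => ?_)
    have hz : Circle.exp (Complex.arg z₀ + (Complex.log ((z : ℂ) * (z₀⁻¹ : Circle))).im) = z := by
      rw [Circle.exp_add, Circle.exp_arg, ← Circle.coe_mul, Complex.log_im, Circle.exp_arg,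
        mul_comm z, mul_inv_cancel_left]
    have := apply_arg_circleExp hp
      (Complex.arg z₀ + (Complex.log ((z : ℂ) * (z₀⁻¹ : Circle))).im)
    rwa [hz] at this

@[simp]
theorem loopOfPeriodic_circleExp {γ : ℝ → M} (hγ : ContMDiff 𝓘(ℝ, ℝ) I ∞ γ)
    (hp : Function.Periodic γ (2 * Real.pi)) (θ : ℝ) :
    loopOfPeriodic γ hγ hp (Circle.exp θ) = γ θ :=
  apply_arg_circleExp hp θ

end Loops

/-! ### Connections and their local expressions -/

section Connections

variable {E : Type*} [NormedAddCommGroup E] [NormedSpace ℝ E]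
  {H : Type*} [TopologicalSpace H] {I : ModelWithCorners ℝ E H}
  {G : Type*} [TopologicalSpace G] [ChartedSpace H G] [Group G]
  [LieGroup I ∞ G]

namespace CircleConnection

/-- The value of a connection at a point of the bundle, as a map between normed spaces. -/
def formCLM (A : CircleConnection I G) (z : Circle) (x : G) :
    EuclideanSpace ℝ (Fin 1) × E →L[ℝ] E := A.form (z, x)

theorem contMDiff_rightMul (g : G) : ContMDiff ((𝓡 1).prod I) ((𝓡 1).prod I) ∞
    (fun q : Circle × G => (q.1, q.2 * g)) :=
  contMDiff_fst.prodMk (contMDiff_snd.mul contMDiff_const)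

theorem formCLM_equivariant (A : CircleConnection I G) (g : G) (z : Circle) (x : G)
    (v : EuclideanSpace ℝ (Fin 1) × E) :
    A.formCLM z (x * g) (mfderiv ((𝓡 1).prod I) ((𝓡 1).prod I)
      (fun q : Circle × G => (q.1, q.2 * g)) (z, x) v) =
      adjointCLM I g⁻¹ (A.formCLM z x v) :=
  A.equivariant g (z, x) v

theorem formCLM_one_vertical (A : CircleConnection I G) (z : Circle) (X : E) :
    A.formCLM z 1 (0, X) = X := by
  have h := A.vertical (z, 1) X
  have e : (fun x : G => (z, (1 : G) * x)) = fun x : G => (z, x) := by simp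
  have h2 : (mfderiv I ((𝓡 1).prod I) (fun x : G => (z, x)) 1 X :
      EuclideanSpace ℝ (Fin 1) × E) = (0, X) := by
    have hm := mfderiv_prodMk (I := I) (I' := 𝓡 1) (I'' := I) (x := (1 : G)) (f := fun _ => z)
      (g := id) mdifferentiableAt_const mdifferentiableAt_id
    exact (DFunLike.congr_fun hm X).trans
      (Prod.ext (DFunLike.congr_fun mfderiv_const X) (DFunLike.congr_fun mfderiv_id X))
  have key : ∀ (f : G → Circle × G) (y : G), f = (fun x : G => (z, x)) → y = 1 →
      A.formCLM z y (mfderiv I ((𝓡 1).prod I) f 1 X) = A.formCLM z 1 (0, X) := by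
    rintro f y rfl rfl
    rw [← h2]
  exact (key _ ((1 : G) * 1) e (mul_one 1)).symm.trans h

theorem formCLM_one_apply (A : CircleConnection I G) (z : Circle)
    (a : EuclideanSpace ℝ (Fin 1)) (X : E) :
    A.formCLM z 1 (a, X) = A.formCLM z 1 (a, 0) + X := by
  conv_rhs => rw [← A.formCLM_one_vertical z X]
  rw [← map_add]
  simp

theorem coeff_eq (A : CircleConnection I G) (θ : ℝ) :
    A.coeff θ = A.formCLM (Circle.exp θ) 1 (circleVelocity θ, 0) := by
  have h2 : (mfderiv 𝓘(ℝ, ℝ) ((𝓡 1).prod I) (fun τ : ℝ => (Circle.exp τ, (1 : G))) θ (1 : ℝ) :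
      EuclideanSpace ℝ (Fin 1) × E) = (circleVelocity θ, 0) := by
    rw [mfderiv_prodMk (mdifferentiableAt_circleExp θ) mdifferentiableAt_const, mfderiv_const]
    rfl
  rw [← h2]
  rfl

theorem ext_of_formCLM_one {A B : CircleConnection I G} [I.Boundaryless]
    (h : ∀ z v, A.formCLM z 1 v = B.formCLM z 1 v) : A = B := by
  ext p v
  obtain ⟨z, x⟩ := p
  have e : x * x⁻¹ = 1 := mul_inv_cancel x
  have hA := A.formCLM_equivariant x⁻¹ z x v
  have hB := B.formCLM_equivariant x⁻¹ z x v
  rw [e] at hA hB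
  have h1 := congrArg (adjointCLM I x⁻¹) (hA.symm.trans ((h z _).trans hB))
  simp only [inv_inv, adjointCLM_inv_apply] at h1
  exact h1

theorem ext_coeff [I.Boundaryless] {A B : CircleConnection I G}
    (h : ∀ θ, A.coeff θ = B.coeff θ) : A = B := by
  refine ext_of_formCLM_one fun z v => ?_
  obtain ⟨θ, rfl⟩ := circleExp_surjective z
  obtain ⟨a, X⟩ := v
  obtain ⟨s, rfl⟩ := exists_smul_circleVelocity θ a
  rw [formCLM_one_apply, formCLM_one_apply B]
  have := h θ
  rw [coeff_eq, coeff_eq] at this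
  have e : ((s • circleVelocity θ, 0) : EuclideanSpace ℝ (Fin 1) × E) =
      s • (circleVelocity θ, 0) := by simp
  rw [e, map_smul, map_smul, this]

theorem contDiff_coeff (A : CircleConnection I G) : ContDiff ℝ ∞ A.coeff := by
  have h1 : ContMDiff 𝓘(ℝ, ℝ) 𝓘(ℝ, ℝ).tangent ∞
      (fun θ : ℝ => (⟨θ, (1 : ℝ)⟩ : TangentBundle 𝓘(ℝ, ℝ) ℝ)) :=
    contMDiff_vectorSpace_iff_contDiff.2 contDiff_const
  have h2 : ContMDiff 𝓘(ℝ, ℝ) ((𝓡 1).prod I) ∞ (fun τ : ℝ => (Circle.exp τ, (1 : G))) :=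
    contMDiff_circleExp.prodMk contMDiff_const
  exact (A.smooth.comp ((h2.contMDiff_tangentMap (m := ∞) le_rfl).comp h1)).contDiff

theorem circleVelocity_periodic : Function.Periodic circleVelocity (2 * Real.pi) := by
  intro θ
  have h := mfderiv_comp_apply (I := 𝓘(ℝ, ℝ)) (I' := 𝓘(ℝ, ℝ)) (I'' := 𝓡 1) θ
    (g := Circle.exp) (f := fun τ : ℝ => τ + 2 * Real.pi)
    (mdifferentiableAt_circleExp _) ((differentiableAt_id.add_const _).mdifferentiableAt) (1 : ℝ)
  have e : Circle.exp ∘ (fun τ : ℝ => τ + 2 * Real.pi) = Circle.exp :=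
    funext fun τ => Circle.periodic_exp τ
  have hd : mfderiv 𝓘(ℝ, ℝ) 𝓘(ℝ, ℝ) (fun τ : ℝ => τ + 2 * Real.pi) θ (1 : ℝ) = (1 : ℝ) := by
    have := ((hasDerivAt_id θ).add_const (2 * Real.pi)).hasFDerivAt.hasMFDerivAt.mfderiv
    erw [this]
    exact one_smul ℝ (1 : ℝ)
  rw [hd] at h
  refine h.symm.trans ?_
  have key : ∀ f : ℝ → Circle, f = Circle.exp →
      (mfderiv 𝓘(ℝ, ℝ) (𝓡 1) f θ (1 : ℝ) : EuclideanSpace ℝ (Fin 1)) = circleVelocity θ := by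
    rintro f rfl; rfl
  exact key _ e

theorem coeff_periodic (A : CircleConnection I G) :
    Function.Periodic A.coeff (2 * Real.pi) := by
  intro θ
  rw [coeff_eq, coeff_eq, circleVelocity_periodic, Circle.periodic_exp]

/-- The value of a connection on the velocity of a curve `(exp(iθ), u θ)` in the bundle. -/
theorem form_curve [I.Boundaryless] (A : CircleConnection I G) {u : ℝ → G} {ξ : E} {θ : ℝ}
    (hu : MDifferentiableAt 𝓘(ℝ, ℝ) I u θ) (h : HasLeftLogDerivAt I u ξ θ) :
    A.form (Circle.exp θ, u θ)
      (mfderiv 𝓘(ℝ, ℝ) ((𝓡 1).prod I) (fun τ : ℝ => (Circle.exp τ, u τ)) θ (1 : ℝ)) =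
      adjointCLM I (u θ)⁻¹ (A.coeff θ) + ξ := by
  set v : ℝ → G := fun τ => u τ * (u θ)⁻¹ with hv
  have hvθ : v θ = 1 := by simp [hv]
  have hR : ∀ g : G, ContMDiff I I ∞ (fun x : G => x * g) :=
    fun g => contMDiff_id.mul contMDiff_const
  have hvd : MDifferentiableAt 𝓘(ℝ, ℝ) I v θ :=
    ((hR (u θ)⁻¹).mdifferentiableAt (by simp)).comp θ hu
  have hvlog := h.mul_const (u θ)⁻¹
  rw [inv_inv] at hvlog
  have hvξ : (mfderiv 𝓘(ℝ, ℝ) I v θ (1 : ℝ) : E) = adjointCLM I (u θ) ξ := by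
    have h1 := (hasLeftLogDerivAt_of_contMDiffAt hvd).unique hvlog
    rw [← h1]
    have key : ∀ f : ℝ → G, f = v → (mfderiv 𝓘(ℝ, ℝ) I v θ (1 : ℝ) : E) =
        mfderiv 𝓘(ℝ, ℝ) I f θ (1 : ℝ) := by rintro f rfl; rfl
    exact key _ (by funext τ; simp [hvθ])
  have hpair : MDifferentiableAt 𝓘(ℝ, ℝ) ((𝓡 1).prod I) (fun τ : ℝ => (Circle.exp τ, v τ)) θ :=
    (mdifferentiableAt_circleExp θ).prodMk hvd
  have hpairv : (mfderiv 𝓘(ℝ, ℝ) ((𝓡 1).prod I) (fun τ : ℝ => (Circle.exp τ, v τ)) θ (1 : ℝ) :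
      EuclideanSpace ℝ (Fin 1) × E) = (circleVelocity θ, adjointCLM I (u θ) ξ) := by
    rw [mfderiv_prodMk (mdifferentiableAt_circleExp θ) hvd]
    rw [← hvξ]
    rfl
  have key : ∀ (f : ℝ → Circle × G) (x : G), f = (fun q : Circle × G => (q.1, q.2 * u θ)) ∘
      (fun τ : ℝ => (Circle.exp τ, v τ)) → x = v θ * u θ →
      A.formCLM (Circle.exp θ) x (mfderiv 𝓘(ℝ, ℝ) ((𝓡 1).prod I) f θ (1 : ℝ)) =
        adjointCLM I (u θ)⁻¹ (A.formCLM (Circle.exp θ) (v θ)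
          (circleVelocity θ, adjointCLM I (u θ) ξ)) := by
    rintro f x rfl rfl
    have h1 := mfderiv_comp_apply (I := 𝓘(ℝ, ℝ)) (I' := (𝓡 1).prod I) (I'' := (𝓡 1).prod I) θ
      ((contMDiff_rightMul (I := I) (u θ)).mdifferentiableAt (by simp)) hpair (1 : ℝ)
    exact (congrArg (A.formCLM (Circle.exp θ) (v θ * u θ)) h1).trans
      ((A.formCLM_equivariant (u θ) (Circle.exp θ) (v θ) _).trans
        (congrArg (fun w => adjointCLM I (u θ)⁻¹ (A.formCLM (Circle.exp θ) (v θ) w)) hpairv))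
  refine (key _ (u θ) (by funext τ; simp [hv]) (by simp [hv])).trans ?_
  rw [hvθ, formCLM_one_apply, map_add, adjointCLM_inv_apply, coeff_eq]

end CircleConnection

variable [I.Boundaryless]

theorem SmoothLoop.contMDiff_comp_circleExp (g : SmoothLoop I G) :
    ContMDiff 𝓘(ℝ, ℝ) I ∞ (fun τ => g (Circle.exp τ)) :=
  g.contMDiff.comp contMDiff_circleExp

theorem SmoothLoop.hasLeftLogDerivAt (g : SmoothLoop I G) (θ : ℝ) :
    HasLeftLogDerivAt I (fun τ => g (Circle.exp τ)) (g.logDeriv θ) θ :=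
  hasLeftLogDerivAt_of_contMDiffAt (g.contMDiff_comp_circleExp.mdifferentiableAt (by simp))

theorem SmoothLoop.contDiff_logDeriv (g : SmoothLoop I G) : ContDiff ℝ ∞ g.logDeriv :=
  contDiff_of_hasLeftLogDerivAt g.contMDiff_comp_circleExp g.hasLeftLogDerivAt

theorem SmoothLoop.logDeriv_periodic (g : SmoothLoop I G) :
    Function.Periodic g.logDeriv (2 * Real.pi) := by
  intro θ
  have h := (g.hasLeftLogDerivAt (θ + 2 * Real.pi)).comp_hasDerivAt (f := fun τ => τ + 2 * Real.pi)
    ((hasDerivAt_id θ).add_const _)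
  simp only [Circle.periodic_exp _, one_smul] at h
  exact h.unique (g.hasLeftLogDerivAt θ)

/-- The local expression of a pulled back connection. -/
theorem CircleConnection.coeff_pullback (A : CircleConnection I G) (g : SmoothLoop I G) (θ : ℝ) :
    (A.pullback g).coeff θ =
      adjointCLM I (g (Circle.exp θ))⁻¹ (A.coeff θ) + g.logDeriv θ := by
  have h := A.form_curve (g.contMDiff_comp_circleExp.mdifferentiableAt (by simp))
    (g.hasLeftLogDerivAt θ)
  rw [← h]
  have hc : MDifferentiableAt 𝓘(ℝ, ℝ) ((𝓡 1).prod I) (fun τ : ℝ => (Circle.exp τ, (1 : G))) θ :=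
    (mdifferentiableAt_circleExp θ).prodMk mdifferentiableAt_const
  have h1 := mfderiv_comp_apply (I := 𝓘(ℝ, ℝ)) (I' := (𝓡 1).prod I) (I'' := (𝓡 1).prod I) θ
    (g := g.gauge) (g.contMDiff_gauge.mdifferentiableAt (by simp)) hc (1 : ℝ)
  have key : ∀ (f : ℝ → Circle × G) (x : G), f = (fun τ => (Circle.exp τ, g (Circle.exp τ))) →
      x = g (Circle.exp θ) →
      A.formCLM (Circle.exp θ) x (mfderiv 𝓘(ℝ, ℝ) ((𝓡 1).prod I) f θ (1 : ℝ)) =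
      A.formCLM (Circle.exp θ) (g (Circle.exp θ)) (mfderiv 𝓘(ℝ, ℝ) ((𝓡 1).prod I)
        (fun τ => (Circle.exp τ, g (Circle.exp τ))) θ (1 : ℝ)) := by
    rintro f x rfl rfl
    rfl
  refine Eq.trans ?_ (key (g.gauge ∘ fun τ : ℝ => (Circle.exp τ, (1 : G)))
    (g (Circle.exp θ) * 1) (by funext τ; simp [SmoothLoop.gauge]) (mul_one _))
  rw [h1]
  rfl

end Connections

/-! ### The connection with a given local expression -/

section Construction

variable {E : Type*} [NormedAddCommGroup E] [NormedSpace ℝ E]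
  {H : Type*} [TopologicalSpace H] (I : ModelWithCorners ℝ E H)
  {G : Type*} [TopologicalSpace G] [ChartedSpace H G] [Group G]

/-- The Maurer–Cartan form of the group factor of `Circle × G`. -/
def fibreMaurerCartan (p : Circle × G) : EuclideanSpace ℝ (Fin 1) × E →L[ℝ] E :=
  mfderiv ((𝓡 1).prod I) I (fun q : Circle × G => p.2⁻¹ * q.2) p

/-- The angular form of the circle factor of `Circle × G`. -/
def circleAngleForm (p : Circle × G) : EuclideanSpace ℝ (Fin 1) × E →L[ℝ] ℝ :=
  (Complex.imCLM.comp (ContinuousLinearMap.mul ℝ ℂ ((p.1⁻¹ : Circle) : ℂ))).comp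
    (mfderiv ((𝓡 1).prod I) 𝓘(ℝ, ℂ) (fun q : Circle × G => (q.1 : ℂ)) p)

variable {I} [LieGroup I ∞ G]

theorem contMDiff_circle_coe_fst :
    ContMDiff ((𝓡 1).prod I) 𝓘(ℝ, ℂ) ∞ (fun q : Circle × G => (q.1 : ℂ)) :=
  contMDiff_circle_coe.comp contMDiff_fst

theorem contMDiff_const_mul_snd (x : G) :
    ContMDiff ((𝓡 1).prod I) I ∞ (fun q : Circle × G => x * q.2) :=
  contMDiff_const.mul contMDiff_snd

theorem contMDiff_circleAngleForm : ContMDiff ((𝓡 1).prod I).tangent 𝓘(ℝ, ℝ) ∞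
    (fun v : TangentBundle ((𝓡 1).prod I) (Circle × G) => circleAngleForm I v.1 v.2) := by
  have h1 : ContMDiff ((𝓡 1).prod I).tangent 𝓘(ℝ, ℂ) ∞
      (fun v : TangentBundle ((𝓡 1).prod I) (Circle × G) =>
        (mfderiv ((𝓡 1).prod I) 𝓘(ℝ, ℂ) (fun q : Circle × G => (q.1 : ℂ)) v.1 v.2 : ℂ)) :=
    (contMDiff_snd_tangentBundle_modelSpace ℂ 𝓘(ℝ, ℂ)).comp
      ((contMDiff_circle_coe_fst (I := I)).contMDiff_tangentMap (m := ∞) le_rfl)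
  have h0 : ContMDiff (𝓡 1) 𝓘(ℝ, ℂ) ∞ (fun z : Circle => ((z⁻¹ : Circle) : ℂ)) :=
    contMDiff_circle_coe.comp (contMDiff_inv (𝓡 1) ∞)
  have h2 : ContMDiff ((𝓡 1).prod I).tangent 𝓘(ℝ, ℂ) ∞
      (fun v : TangentBundle ((𝓡 1).prod I) (Circle × G) => ((v.1.1⁻¹ : Circle) : ℂ)) :=
    h0.comp (contMDiff_fst.comp (Bundle.contMDiff_proj _))
  have h3 : ContDiff ℝ ∞ (fun w : ℂ × ℂ => (w.1 * w.2).im) :=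
    Complex.imCLM.contDiff.comp contDiff_mul
  exact h3.contMDiff.comp (h2.prodMk_space h1)

theorem contMDiff_fibreMaurerCartan : ContMDiff ((𝓡 1).prod I).tangent 𝓘(ℝ, E) ∞
    (fun v : TangentBundle ((𝓡 1).prod I) (Circle × G) => fibreMaurerCartan I v.1 v.2) := by
  let J := (𝓡 1).prod I
  have hμ : ContMDiff (J.prod J) I ∞
      (fun q : (Circle × G) × (Circle × G) => q.1.2⁻¹ * q.2.2) :=
    (contMDiff_snd.comp contMDiff_fst).inv.mul (contMDiff_snd.comp contMDiff_snd)
  have hz : ContMDiff J.tangent J.tangent ∞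
      (fun v : TangentBundle J (Circle × G) =>
        (⟨v.1, 0⟩ : TangentBundle J (Circle × G))) :=
    (Bundle.contMDiff_zeroSection ℝ (TangentSpace J : Circle × G → Type _)).comp
      (Bundle.contMDiff_proj _)
  have hS : ContMDiff J.tangent I.tangent ∞
      (fun v : TangentBundle J (Circle × G) => tangentMap (J.prod J) I
        (fun q : (Circle × G) × (Circle × G) => q.1.2⁻¹ * q.2.2)
        ((equivTangentBundleProd J (Circle × G) J (Circle × G)).symm (⟨v.1, 0⟩, v))) :=
    (hμ.contMDiff_tangentMap (m := ∞) le_rfl).comp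
      (contMDiff_equivTangentBundleProd_symm.comp (hz.prodMk contMDiff_id))
  intro v₀
  have h2 := (Bundle.contMDiffAt_totalSpace.1 (hS v₀)).2
  refine h2.congr_of_eventuallyEq (Eventually.of_forall fun v => ?_)
  have hval : (tangentMap (J.prod J) I
        (fun q : (Circle × G) × (Circle × G) => q.1.2⁻¹ * q.2.2)
        ((equivTangentBundleProd J (Circle × G) J (Circle × G)).symm (⟨v.1, 0⟩, v))) =
      (⟨1, (fibreMaurerCartan I v.1 v.2 : E)⟩ : TangentBundle I G) := by
    have h3 := mfderiv_prod_eq_add_apply (I := J) (I' := J) (I'' := I) (p := (v.1, v.1))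
      (v := ((0 : EuclideanSpace ℝ (Fin 1) × E), (v.2 : EuclideanSpace ℝ (Fin 1) × E)))
      (hμ.mdifferentiableAt (by simp))
    have h4 : (mfderiv (J.prod J) I (fun q : (Circle × G) × (Circle × G) => q.1.2⁻¹ * q.2.2)
        (v.1, v.1) ((0 : EuclideanSpace ℝ (Fin 1) × E), (v.2 : EuclideanSpace ℝ (Fin 1) × E)) : E) =
        fibreMaurerCartan I v.1 v.2 := by
      refine h3.trans ?_
      refine (congrArg (· + _) (map_zero _)).trans ?_
      exact zero_add _
    have key : ∀ (x : G) (w : E), x = 1 → w = fibreMaurerCartan I v.1 v.2 →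
        (⟨x, w⟩ : TangentBundle I G) = ⟨1, (fibreMaurerCartan I v.1 v.2 : E)⟩ := by
      rintro x w rfl rfl; rfl
    exact key _ _ (inv_mul_cancel v.1.2) h4
  have hb : (tangentMap (J.prod J) I
        (fun q : (Circle × G) × (Circle × G) => q.1.2⁻¹ * q.2.2)
        ((equivTangentBundleProd J (Circle × G) J (Circle × G)).symm (⟨v₀.1, 0⟩, v₀))).proj = 1 :=
    inv_mul_cancel v₀.1.2
  simp only [hval, hb]
  have h5 := (tangentBundleCore I G).coordChange_self (achart H 1) 1 (mem_achart_source H 1)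
    (fibreMaurerCartan I v.1 v.2)
  exact h5.symm

theorem circleAngleForm_comp {F' H' M' : Type*} [NormedAddCommGroup F'] [NormedSpace ℝ F']
    [TopologicalSpace H'] {J : ModelWithCorners ℝ F' H'} [TopologicalSpace M'] [ChartedSpace H' M']
    {f : M' → Circle × G} {x : M'} (hf : MDifferentiableAt J ((𝓡 1).prod I) f x)
    (v : TangentSpace J x) :
    circleAngleForm I (f x) (mfderiv J ((𝓡 1).prod I) f x v) =
      (ContinuousLinearMap.mul ℝ ℂ (((f x).1⁻¹ : Circle) : ℂ)
        (mfderiv J 𝓘(ℝ, ℂ) (fun y => ((f y).1 : ℂ)) x v)).im := by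
  have h := mfderiv_comp_apply (I := J) (I' := (𝓡 1).prod I) (I'' := 𝓘(ℝ, ℂ)) x
    (g := fun q : Circle × G => (q.1 : ℂ))
    ((contMDiff_circle_coe_fst (I := I)).mdifferentiableAt (by simp)) hf v
  exact congrArg (fun w : ℂ => (ContinuousLinearMap.mul ℝ ℂ (((f x).1⁻¹ : Circle) : ℂ) w).im) h.symm

theorem fibreMaurerCartan_comp {F' H' M' : Type*} [NormedAddCommGroup F'] [NormedSpace ℝ F']
    [TopologicalSpace H'] {J : ModelWithCorners ℝ F' H'} [TopologicalSpace M'] [ChartedSpace H' M']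
    {f : M' → Circle × G} {x : M'} (hf : MDifferentiableAt J ((𝓡 1).prod I) f x)
    (v : TangentSpace J x) :
    fibreMaurerCartan I (f x) (mfderiv J ((𝓡 1).prod I) f x v) =
      (mfderiv J I (fun y => (f x).2⁻¹ * (f y).2) x v : E) :=
  (mfderiv_comp_apply (I := J) (I' := (𝓡 1).prod I) (I'' := I) x
    (g := fun q : Circle × G => (f x).2⁻¹ * q.2)
    ((contMDiff_const_mul_snd (I := I) (f x).2⁻¹).mdifferentiableAt (by simp)) hf v).symm

variable [I.Boundaryless]

theorem circleAngleForm_rightMul (g : G) (p : Circle × G)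
    (v : TangentSpace ((𝓡 1).prod I) p) :
    circleAngleForm I (p.1, p.2 * g) (mfderiv ((𝓡 1).prod I) ((𝓡 1).prod I)
      (fun q : Circle × G => (q.1, q.2 * g)) p v) = circleAngleForm I p v :=
  circleAngleForm_comp ((CircleConnection.contMDiff_rightMul (I := I) g).mdifferentiableAt
    (by simp)) v

theorem fibreMaurerCartan_rightMul (g : G) (p : Circle × G)
    (v : TangentSpace ((𝓡 1).prod I) p) :
    fibreMaurerCartan I (p.1, p.2 * g) (mfderiv ((𝓡 1).prod I) ((𝓡 1).prod I)
      (fun q : Circle × G => (q.1, q.2 * g)) p v) =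
      adjointCLM I g⁻¹ (fibreMaurerCartan I p v) := by
  refine (fibreMaurerCartan_comp ((CircleConnection.contMDiff_rightMul (I := I) g).mdifferentiableAt
    (by simp)) v).trans ?_
  have h := mfderiv_comp_apply (I := (𝓡 1).prod I) (I' := I) (I'' := I) p
    (g := fun x : G => g⁻¹ * x * g⁻¹⁻¹) (f := fun q : Circle × G => p.2⁻¹ * q.2)
    ((contMDiff_conj g⁻¹).mdifferentiableAt (by simp))
    ((contMDiff_const_mul_snd (I := I) p.2⁻¹).mdifferentiableAt (by simp)) v
  have key : ∀ (f : Circle × G → G) (x : G), f = (fun x : G => g⁻¹ * x * g⁻¹⁻¹) ∘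
      (fun q : Circle × G => p.2⁻¹ * q.2) → x = p.2⁻¹ * p.2 →
      (mfderiv ((𝓡 1).prod I) I f p v : E) = mfderiv I I (fun x : G => g⁻¹ * x * g⁻¹⁻¹) x
        (fibreMaurerCartan I p v : E) := by
    rintro f x rfl rfl
    exact h
  exact key _ 1 (by funext q; simp [mul_assoc]) (inv_mul_cancel _).symm

theorem circleAngleForm_vertical (p : Circle × G) (X : GroupLieAlgebra I G) :
    circleAngleForm I (p.1, p.2 * 1)
      (mfderiv I ((𝓡 1).prod I) (fun x : G => (p.1, p.2 * x)) 1 X) = 0 := by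
  have hR : ContMDiff I ((𝓡 1).prod I) ∞ (fun x : G => (p.1, p.2 * x)) :=
    contMDiff_const.prodMk (contMDiff_const.mul contMDiff_id)
  refine (circleAngleForm_comp (hR.mdifferentiableAt (x := (1 : G)) (by simp)) X).trans ?_
  have h : (mfderiv I 𝓘(ℝ, ℂ) (fun _ : G => (p.1 : ℂ)) 1 X : ℂ) = 0 :=
    DFunLike.congr_fun mfderiv_const X
  refine (congrArg (fun w : ℂ => (((p.1⁻¹ : Circle) : ℂ) * w).im) h).trans ?_
  exact congrArg Complex.im (mul_zero (M₀ := ℂ) _)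

theorem fibreMaurerCartan_vertical (p : Circle × G) (X : GroupLieAlgebra I G) :
    fibreMaurerCartan I (p.1, p.2 * 1)
      (mfderiv I ((𝓡 1).prod I) (fun x : G => (p.1, p.2 * x)) 1 X) = X := by
  have hR : ContMDiff I ((𝓡 1).prod I) ∞ (fun x : G => (p.1, p.2 * x)) :=
    contMDiff_const.prodMk (contMDiff_const.mul contMDiff_id)
  refine (fibreMaurerCartan_comp (hR.mdifferentiableAt (x := (1 : G)) (by simp)) X).trans ?_
  have key : ∀ f : G → G, f = id → (mfderiv I I f 1 X : E) = X := by
    rintro f rfl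
    exact DFunLike.congr_fun mfderiv_id X
  exact key _ (by funext x; simp)

/-- The connection whose local expression is a given curve in the Lie algebra. -/
def CircleConnection.ofLoop (f : C^∞⟮𝓡 1, Circle; 𝓘(ℝ, E), E⟯) : CircleConnection I G where
  form p := (((adjointCLM I p.2⁻¹).comp ((circleAngleForm I p).smulRight (f p.1)) +
    fibreMaurerCartan I p : EuclideanSpace ℝ (Fin 1) × E →L[ℝ] E))
  smooth := by
    have hp1 : ContMDiff ((𝓡 1).prod I).tangent (𝓡 1) ∞
        (fun v : TangentBundle ((𝓡 1).prod I) (Circle × G) => v.1.1) :=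
      contMDiff_fst.comp (Bundle.contMDiff_proj _)
    have hp2 : ContMDiff ((𝓡 1).prod I).tangent I ∞
        (fun v : TangentBundle ((𝓡 1).prod I) (Circle × G) => v.1.2⁻¹) :=
      (contMDiff_snd.comp (Bundle.contMDiff_proj _)).inv
    have h1 := (contMDiff_adjointCLM (I := I) (G := G)).comp hp2
    have h2 := (contMDiff_circleAngleForm (I := I) (G := G)).smul (f.contMDiff.comp hp1)
    exact (h1.clm_apply h2).add contMDiff_fibreMaurerCartan
  vertical p X := by
    have h : adjointCLM I (p.2 * 1)⁻¹ (circleAngleForm I (p.1, p.2 * 1)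
        (mfderiv I ((𝓡 1).prod I) (fun x : G => (p.1, p.2 * x)) 1 X) • f p.1) +
        fibreMaurerCartan I (p.1, p.2 * 1)
        (mfderiv I ((𝓡 1).prod I) (fun x : G => (p.1, p.2 * x)) 1 X) = X := by
      rw [circleAngleForm_vertical, fibreMaurerCartan_vertical, zero_smul, map_zero]
      exact zero_add (M := E) X
    exact h
  equivariant g p v := by
    have h : adjointCLM I (p.2 * g)⁻¹ (circleAngleForm I (p.1, p.2 * g)
        (mfderiv ((𝓡 1).prod I) ((𝓡 1).prod I) (fun q : Circle × G => (q.1, q.2 * g)) p v)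
          • f p.1) + fibreMaurerCartan I (p.1, p.2 * g)
        (mfderiv ((𝓡 1).prod I) ((𝓡 1).prod I) (fun q : Circle × G => (q.1, q.2 * g)) p v) =
        adjointCLM I g⁻¹ (adjointCLM I p.2⁻¹ (circleAngleForm I p v • f p.1) +
          fibreMaurerCartan I p v) := by
      rw [circleAngleForm_rightMul, fibreMaurerCartan_rightMul, mul_inv_rev, adjointCLM_mul,
        map_add, ContinuousLinearMap.comp_apply]
    exact h

theorem CircleConnection.coeff_ofLoop (f : C^∞⟮𝓡 1, Circle; 𝓘(ℝ, E), E⟯) (θ : ℝ) :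
    (ofLoop f : CircleConnection I G).coeff θ = f (Circle.exp θ) := by
  have hc : MDifferentiableAt 𝓘(ℝ, ℝ) ((𝓡 1).prod I) (fun τ : ℝ => (Circle.exp τ, (1 : G))) θ :=
    (mdifferentiableAt_circleExp θ).prodMk mdifferentiableAt_const
  have h1 : circleAngleForm I (Circle.exp θ, (1 : G)) (mfderiv 𝓘(ℝ, ℝ) ((𝓡 1).prod I)
      (fun τ : ℝ => (Circle.exp τ, (1 : G))) θ (1 : ℝ)) = 1 := by
    refine (circleAngleForm_comp hc (1 : ℝ)).trans ?_
    have h := (hasDerivAt_coe_circleExp θ).hasFDerivAt.hasMFDerivAt.mfderiv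
    have h' : (mfderiv 𝓘(ℝ, ℝ) 𝓘(ℝ, ℂ) (fun τ : ℝ => (Circle.exp τ : ℂ)) θ (1 : ℝ) : ℂ) =
        (Circle.exp θ : ℂ) * Complex.I :=
      (DFunLike.congr_fun h (1 : ℝ)).trans (one_smul ℝ _)
    refine (congrArg (fun w : ℂ => ((((Circle.exp θ)⁻¹ : Circle) : ℂ) * w).im) h').trans ?_
    simp
  have h2 : fibreMaurerCartan I (Circle.exp θ, (1 : G)) (mfderiv 𝓘(ℝ, ℝ) ((𝓡 1).prod I)
      (fun τ : ℝ => (Circle.exp τ, (1 : G))) θ (1 : ℝ)) = 0 :=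
    (fibreMaurerCartan_comp hc (1 : ℝ)).trans
      (DFunLike.congr_fun (mfderiv_const (I := 𝓘(ℝ, ℝ)) (I' := I) (x := θ)
        (c := (1 : G)⁻¹ * 1)) (1 : ℝ))
  have h : adjointCLM I (1 : G)⁻¹ (circleAngleForm I (Circle.exp θ, (1 : G)) (mfderiv 𝓘(ℝ, ℝ)
      ((𝓡 1).prod I) (fun τ : ℝ => (Circle.exp τ, (1 : G))) θ (1 : ℝ)) • f (Circle.exp θ)) +
      fibreMaurerCartan I (Circle.exp θ, (1 : G)) (mfderiv 𝓘(ℝ, ℝ)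
      ((𝓡 1).prod I) (fun τ : ℝ => (Circle.exp τ, (1 : G))) θ (1 : ℝ)) = f (Circle.exp θ) := by
    rw [h1, h2, one_smul, inv_one, adjointCLM_one, add_zero, ContinuousLinearMap.id_apply]
  exact h

/-- Every smooth periodic curve in the Lie algebra is the local expression of a connection. -/
theorem CircleConnection.exists_coeff_eq {c : ℝ → E} (hc : ContDiff ℝ ∞ c)
    (hp : Function.Periodic c (2 * Real.pi)) : ∃ A : CircleConnection I G, A.coeff = c :=
  ⟨ofLoop (loopOfPeriodic c hc.contMDiff hp), funext fun θ => by
    rw [coeff_ofLoop, loopOfPeriodic_circleExp]⟩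

end Construction

/-! ### Families of smooth curves -/

section Families

variable {V W Z : Type*} [NormedAddCommGroup V] [NormedSpace ℝ V] [NormedAddCommGroup W]
  [NormedSpace ℝ W] [NormedAddCommGroup Z] [NormedSpace ℝ Z]
  {X Y : Type*} [TopologicalSpace X] [TopologicalSpace Y]

/-- A family of smooth curves whose derivatives up to the order `n` are jointly continuous in the
parameter and the time. -/
def IsCkFamily (n : ℕ) (f : X → ℝ → V) : Prop :=
  (∀ x, ContDiff ℝ ∞ (f x)) ∧ ∀ k ≤ n, Continuous fun p : X × ℝ => iteratedDeriv k (f p.1) p.2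

namespace IsCkFamily

variable {n : ℕ} {f : X → ℝ → V} {g : X → ℝ → W}

theorem continuous (h : IsCkFamily n f) : Continuous fun p : X × ℝ => f p.1 p.2 := by
  simpa using h.2 0 (Nat.zero_le n)

theorem of_le {m : ℕ} (h : IsCkFamily n f) (hm : m ≤ n) : IsCkFamily m f :=
  ⟨h.1, fun k hk => h.2 k (hk.trans hm)⟩

theorem succ_iff : IsCkFamily (n + 1) f ↔ (∀ x, ContDiff ℝ ∞ (f x)) ∧
    (Continuous fun p : X × ℝ => f p.1 p.2) ∧ IsCkFamily n fun x => deriv (f x) := by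
  refine ⟨fun h => ⟨h.1, h.continuous, fun x => (contDiff_infty_iff_deriv.1 (h.1 x)).2,
    fun k hk => ?_⟩, fun h => ⟨h.1, fun k hk => ?_⟩⟩
  · simpa only [iteratedDeriv_succ'] using h.2 (k + 1) (Nat.succ_le_succ hk)
  · cases k with
    | zero => simpa using h.2.1
    | succ k => simpa only [iteratedDeriv_succ'] using h.2.2.2 k (Nat.le_of_succ_le_succ hk)

theorem of_hasDerivAt {f' : X → ℝ → V} (hf : Continuous fun p : X × ℝ => f p.1 p.2)
    (hd : ∀ x θ, HasDerivAt (f x) (f' x θ) θ) (hf' : IsCkFamily n f') : IsCkFamily (n + 1) f := by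
  have e : ∀ x, deriv (f x) = f' x := fun x => funext fun θ => (hd x θ).deriv
  refine succ_iff.2 ⟨fun x => contDiff_infty_iff_deriv.2
    ⟨fun θ => (hd x θ).differentiableAt, ?_⟩, hf, ?_⟩
  · rw [e]; exact hf'.1 x
  · simpa only [e] using hf'

theorem comp (h : IsCkFamily n f) {φ : Y → X} (hφ : Continuous φ) :
    IsCkFamily n fun y => f (φ y) :=
  ⟨fun y => h.1 (φ y), fun k hk =>
    (h.2 k hk).comp ((hφ.comp continuous_fst).prodMk continuous_snd)⟩

theorem const {f : ℝ → V} (h : ContDiff ℝ ∞ f) : IsCkFamily n fun _ : X => f :=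
  ⟨fun _ => h, fun k _ => (h.continuous_iteratedDeriv k (mod_cast le_top)).comp continuous_snd⟩

theorem add {g : X → ℝ → V} (hf : IsCkFamily n f) (hg : IsCkFamily n g) :
    IsCkFamily n fun x θ => f x θ + g x θ := by
  refine ⟨fun x => (hf.1 x).add (hg.1 x), fun k hk => ?_⟩
  refine ((hf.2 k hk).add (hg.2 k hk)).congr fun p => ?_
  exact (iteratedDeriv_fun_add ((hf.1 p.1).contDiffAt.of_le (mod_cast le_top))
    ((hg.1 p.1).contDiffAt.of_le (mod_cast le_top))).symm

theorem bilin (B : V →L[ℝ] W →L[ℝ] Z) (hf : IsCkFamily n f) (hg : IsCkFamily n g) :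
    IsCkFamily n fun x θ => B (f x θ) (g x θ) := by
  have hs : ∀ {f : X → ℝ → V} {g : X → ℝ → W}, (∀ x, ContDiff ℝ ∞ (f x)) →
      (∀ x, ContDiff ℝ ∞ (g x)) → ∀ x, ContDiff ℝ ∞ fun θ => B (f x θ) (g x θ) :=
    fun hf hg x => (B.contDiff.comp (hf x)).clm_apply (hg x)
  have hc : ∀ {f : X → ℝ → V} {g : X → ℝ → W}, (Continuous fun p : X × ℝ => f p.1 p.2) →
      (Continuous fun p : X × ℝ => g p.1 p.2) →
      Continuous fun p : X × ℝ => B (f p.1 p.2) (g p.1 p.2) :=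
    fun hf hg => (B.continuous.comp hf).clm_apply hg
  induction n generalizing f g with
  | zero =>
    refine ⟨hs hf.1 hg.1, fun k hk => ?_⟩
    obtain rfl : k = 0 := by omega
    simpa using hc hf.continuous hg.continuous
  | succ n ih =>
    have hf' := succ_iff.1 hf
    have hg' := succ_iff.1 hg
    refine of_hasDerivAt (hc hf.continuous hg.continuous) (fun x θ => ?_)
      ((ih (hf.of_le n.le_succ) hg'.2.2).add (ih hf'.2.2 (hg.of_le n.le_succ)))
    have h1 := ((hf.1 x).differentiable (by simp) θ).hasDerivAt
    have h2 := ((hg.1 x).differentiable (by simp) θ).hasDerivAt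
    rw [add_comm]
    exact (B.hasFDerivAt.comp_hasDerivAt θ h1).clm_apply h2

theorem clm (L : V →L[ℝ] Z) (hf : IsCkFamily n f) : IsCkFamily n fun x θ => L (f x θ) :=
  bilin (ContinuousLinearMap.id ℝ (V →L[ℝ] Z)) (const (X := X) (f := fun _ => L) contDiff_const) hf

theorem neg (hf : IsCkFamily n f) : IsCkFamily n fun x θ => -f x θ :=
  hf.clm (-ContinuousLinearMap.id ℝ V)

theorem clm_apply {f : X → ℝ → V →L[ℝ] W} {g : X → ℝ → V} (hf : IsCkFamily n f)
    (hg : IsCkFamily n g) : IsCkFamily n fun x θ => f x θ (g x θ) :=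
  bilin (ContinuousLinearMap.id ℝ (V →L[ℝ] W)) hf hg

theorem clm_comp {f : X → ℝ → W →L[ℝ] Z} {g : X → ℝ → V →L[ℝ] W} (hf : IsCkFamily n f)
    (hg : IsCkFamily n g) : IsCkFamily n fun x θ => (f x θ).comp (g x θ) :=
  bilin (ContinuousLinearMap.compL ℝ V W Z) hf hg

end IsCkFamily

theorem periodic_iteratedDeriv {f : ℝ → V} {T : ℝ} (hf : Function.Periodic f T) (k : ℕ) :
    Function.Periodic (iteratedDeriv k f) T := by
  intro θ
  have h := iteratedDeriv_comp_add_const k f T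
  rw [show (fun z => f (z + T)) = f from funext hf] at h
  exact (congrFun h θ).symm

/-- For families of continuous periodic curves, uniform continuity in the parameter amounts to joint
continuity. -/
theorem continuous_uniformFun_iff_of_periodic {f : X → ℝ → V} {T : ℝ} (hT : 0 < T)
    (hf : ∀ x, Continuous (f x)) (hp : ∀ x, Function.Periodic (f x) T) :
    (Continuous fun x => UniformFun.ofFun (f x)) ↔ Continuous fun p : X × ℝ => f p.1 p.2 := by
  simp only [continuous_iff_continuousAt, ContinuousAt, UniformFun.tendsto_iff_tendstoUniformly,
    Metric.tendstoUniformly_iff]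
  constructor
  · rintro h ⟨x₀, θ₀⟩
    rw [Metric.tendsto_nhds]
    intro ε hε
    have h1 := (h x₀ (ε / 2) (half_pos hε)).prod_inl_nhds θ₀
    have h2 := (Metric.tendsto_nhds.1 ((hf x₀).tendsto θ₀) (ε / 2) (half_pos hε)).prod_inr_nhds x₀
    filter_upwards [h1, h2] with p hp1 hp2
    have h3 : dist (f x₀ p.2) (f p.1 p.2) < ε / 2 := hp1 p.2
    calc dist (f p.1 p.2) (f x₀ θ₀)
        ≤ dist (f p.1 p.2) (f x₀ p.2) + dist (f x₀ p.2) (f x₀ θ₀) := dist_triangle _ _ _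
      _ < ε / 2 + ε / 2 := add_lt_add (by rwa [dist_comm]) hp2
      _ = ε := add_halves ε
  · intro h x₀ ε hε
    have hc : Continuous fun p : X × ℝ => f p.1 p.2 := continuous_iff_continuousAt.2 h
    have hd : Continuous fun p : X × ℝ => dist (f x₀ p.2) (f p.1 p.2) :=
      ((hf x₀).comp continuous_snd).dist hc
    have hev : ∀ᶠ x in 𝓝 x₀, ∀ θ ∈ Icc 0 T, dist (f x₀ θ) (f x θ) < ε := by
      refine isCompact_Icc.eventually_forall_of_forall_eventually fun θ _ => ?_
      exact hd.continuousAt (x := (x₀, θ)).eventually (gt_mem_nhds (by simpa using hε))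
    filter_upwards [hev] with x hx θ
    have hpp : Function.Periodic (fun θ => (f x₀ θ, f x θ)) T := fun θ => by
      simp [hp x₀ θ, hp x θ]
    obtain ⟨θ', hθ', e⟩ := hpp.exists_mem_Ico₀ hT θ
    have e1 : f x₀ θ = f x₀ θ' := congrArg Prod.fst e
    have e2 : f x θ = f x θ' := congrArg Prod.snd e
    change dist (f x₀ θ) (f x θ) < ε
    rw [e1, e2]
    exact hx θ' (Ico_subset_Icc_self hθ')

/-- Continuity of a map into a space of smooth periodic curves. -/
theorem continuous_smoothCurveTopology_iff {a : Y → ℝ → V} {T : ℝ} (hT : 0 < T)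
    (ha : ∀ y, ContDiff ℝ ∞ (a y)) (hp : ∀ y, Function.Periodic (a y) T) {F : X → Y} :
    (@Continuous X Y _ (smoothCurveTopology a) F) ↔ ∀ n, IsCkFamily n fun x => a (F x) := by
  rw [continuous_iInf_rng]
  have key : ∀ k, (@Continuous X Y _ (TopologicalSpace.induced
      (fun x => UniformFun.ofFun (iteratedDeriv k (a x)))
      (inferInstance : TopologicalSpace (UniformFun ℝ V))) F) ↔
      Continuous fun p : X × ℝ => iteratedDeriv k (a (F p.1)) p.2 := fun k => by
    rw [continuous_induced_rng]
    exact continuous_uniformFun_iff_of_periodic hT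
      (fun x => (ha (F x)).continuous_iteratedDeriv k (mod_cast le_top))
      (fun x => periodic_iteratedDeriv (hp (F x)) k)
  simp only [key]
  exact ⟨fun h n => ⟨fun x => ha (F x), fun k _ => h k⟩, fun h k => (h k).2 k le_rfl⟩

end Families

section Topologies

variable {E : Type*} [NormedAddCommGroup E] [NormedSpace ℝ E]
  {H : Type*} [TopologicalSpace H] {I : ModelWithCorners ℝ E H}
  {G : Type*} [TopologicalSpace G] [ChartedSpace H G] [Group G]
  [LieGroup I ∞ G] [I.Boundaryless] {X : Type*} [TopologicalSpace X]

section Adjoint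

variable [CompleteSpace E] {n : ℕ} {h : X → ℝ → G} {c : X → ℝ → E}

theorem IsCkFamily.adjointCLM (hh : Continuous fun p : X × ℝ => h p.1 p.2)
    (hl : ∀ x θ, HasLeftLogDerivAt I (h x) (c x θ) θ) (hc : IsCkFamily n c) :
    IsCkFamily (n + 1) fun x θ => adjointCLM I (h x θ) := by
  have h0 : Continuous fun p : X × ℝ => _root_.adjointCLM I (h p.1 p.2) :=
    continuous_adjointCLM.comp hh
  induction n with
  | zero =>
    refine of_hasDerivAt h0 (fun x θ => (hl x θ).adjointCLM) (clm_comp ?_ (hc.clm _))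
    refine ⟨fun x => ((contMDiff_adjointCLM (I := I) (G := G)).comp
      (contMDiff_of_hasLeftLogDerivAt (hc.1 x) (hl x))).contDiff, fun k hk => ?_⟩
    obtain rfl : k = 0 := by omega
    simpa using h0
  | succ n ih =>
    exact of_hasDerivAt h0 (fun x θ => (hl x θ).adjointCLM)
      ((ih (hc.of_le n.le_succ)).clm_comp (hc.clm (adjointDeriv I G)))

theorem IsCkFamily.adjointCLM_inv (hh : Continuous fun p : X × ℝ => h p.1 p.2)
    (hl : ∀ x θ, HasLeftLogDerivAt I (h x) (c x θ) θ) (hc : IsCkFamily n c) :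
    IsCkFamily (n + 1) fun x θ => _root_.adjointCLM I (h x θ)⁻¹ := by
  have := topologicalGroup_of_lieGroup I ∞ (G := G)
  have h0 : Continuous fun p : X × ℝ => _root_.adjointCLM I (h p.1 p.2)⁻¹ :=
    continuous_adjointCLM.comp hh.inv
  induction n with
  | zero =>
    refine of_hasDerivAt h0 (fun x θ => (hl x θ).adjointCLM_inv)
      (neg (clm_comp (hc.clm (adjointDeriv I G)) ?_))
    refine ⟨fun x => ((contMDiff_adjointCLM (I := I) (G := G)).comp
      (contMDiff_of_hasLeftLogDerivAt (hc.1 x) (hl x)).inv).contDiff, fun k hk => ?_⟩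
    obtain rfl : k = 0 := by omega
    simpa using h0
  | succ n ih =>
    exact of_hasDerivAt h0 (fun x θ => (hl x θ).adjointCLM_inv)
      (neg ((hc.clm (adjointDeriv I G)).clm_comp (ih (hc.of_le n.le_succ))))

end Adjoint

theorem CircleConnection.continuous_iff {F : X → CircleConnection I G} :
    Continuous F ↔ ∀ n, IsCkFamily n fun x => (F x).coeff :=
  continuous_smoothCurveTopology_iff Real.two_pi_pos (fun A => A.contDiff_coeff)
    fun A => A.coeff_periodic

theorem SmoothLoop.continuous_iff {F : X → SmoothLoop I G} :
    Continuous F ↔ (Continuous fun p : X × Circle => F p.1 p.2) ∧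
      ∀ n, IsCkFamily n fun x => (F x).logDeriv := by
  have h0 := @continuous_inf_rng X (SmoothLoop I G) F inferInstance
    (TopologicalSpace.induced (fun g => (g : C(Circle, G))) ContinuousMap.compactOpen)
    (smoothCurveTopology SmoothLoop.logDeriv)
  have h := continuous_smoothCurveTopology_iff (F := F) (a := SmoothLoop.logDeriv (I := I) (G := G))
    Real.two_pi_pos (fun g => g.contDiff_logDeriv) fun g => g.logDeriv_periodic
  refine h0.trans (and_congr ?_ h)
  rw [continuous_induced_rng]
  constructor
  · intro h
    have h2 : Continuous fun p : X × Circle => (((F p.1 : C(Circle, G))), p.2) :=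
      (h.comp continuous_fst).prodMk continuous_snd
    exact continuous_eval.comp h2
  · intro h
    exact ContinuousMap.continuous_of_continuous_uncurry _ h

theorem CircleConnection.isCkFamily_coeff (n : ℕ) :
    IsCkFamily n fun A : CircleConnection I G => A.coeff :=
  CircleConnection.continuous_iff.1 continuous_id n

theorem SmoothLoop.isCkFamily_logDeriv (n : ℕ) :
    IsCkFamily n fun g : SmoothLoop I G => g.logDeriv :=
  (SmoothLoop.continuous_iff.1 continuous_id).2 n

theorem SmoothLoop.continuous_eval :
    Continuous fun p : SmoothLoop I G × Circle => p.1 p.2 :=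
  (SmoothLoop.continuous_iff.1 continuous_id).1

theorem SmoothLoop.continuous_eval_circleExp :
    Continuous fun p : SmoothLoop I G × ℝ => p.1 (Circle.exp p.2) :=
  SmoothLoop.continuous_eval.comp
    (continuous_fst.prodMk (Circle.exp.continuous.comp continuous_snd))

variable [CompleteSpace E]

theorem SmoothLoop.isCkFamily_adjointCLM (n : ℕ) :
    IsCkFamily n fun (g : SmoothLoop I G) θ => adjointCLM I (g (Circle.exp θ)) :=
  (IsCkFamily.adjointCLM SmoothLoop.continuous_eval_circleExp
    (fun g θ => g.hasLeftLogDerivAt θ) (SmoothLoop.isCkFamily_logDeriv n)).of_le n.le_succ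

theorem SmoothLoop.isCkFamily_adjointCLM_inv (n : ℕ) :
    IsCkFamily n fun (g : SmoothLoop I G) θ => adjointCLM I (g (Circle.exp θ))⁻¹ :=
  (IsCkFamily.adjointCLM_inv SmoothLoop.continuous_eval_circleExp
    (fun g θ => g.hasLeftLogDerivAt θ) (SmoothLoop.isCkFamily_logDeriv n)).of_le n.le_succ

theorem SmoothLoop.logDeriv_mul (g h : SmoothLoop I G) (θ : ℝ) :
    (g * h).logDeriv θ = adjointCLM I (h (Circle.exp θ))⁻¹ (g.logDeriv θ) + h.logDeriv θ :=
  ((g * h).hasLeftLogDerivAt θ).unique ((g.hasLeftLogDerivAt θ).mul (h.hasLeftLogDerivAt θ))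

theorem SmoothLoop.logDeriv_inv (g : SmoothLoop I G) (θ : ℝ) :
    g⁻¹.logDeriv θ = -adjointCLM I (g (Circle.exp θ)) (g.logDeriv θ) :=
  (g⁻¹.hasLeftLogDerivAt θ).unique (g.hasLeftLogDerivAt θ).inv

variable (I G) in
theorem SmoothLoop.isTopologicalGroup : IsTopologicalGroup (SmoothLoop I G) where
  continuous_mul := by
    have := topologicalGroup_of_lieGroup I ∞ (G := G)
    refine SmoothLoop.continuous_iff.2 ⟨?_, fun n => ?_⟩
    · have h1 : Continuous fun p : (SmoothLoop I G × SmoothLoop I G) × Circle => p.1.1 p.2 :=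
        SmoothLoop.continuous_eval.comp
          ((continuous_fst.comp continuous_fst).prodMk continuous_snd)
      have h2 : Continuous fun p : (SmoothLoop I G × SmoothLoop I G) × Circle => p.1.2 p.2 :=
        SmoothLoop.continuous_eval.comp
          ((continuous_snd.comp continuous_fst).prodMk continuous_snd)
      exact h1.mul h2
    · have h := (((SmoothLoop.isCkFamily_adjointCLM_inv (I := I) (G := G) n).comp
        (Y := SmoothLoop I G × SmoothLoop I G) continuous_snd).clm_apply
          ((SmoothLoop.isCkFamily_logDeriv n).comp continuous_fst)).add
            ((SmoothLoop.isCkFamily_logDeriv n).comp continuous_snd)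
      convert! h using 3
      exact SmoothLoop.logDeriv_mul _ _ _
  continuous_inv := by
    have := topologicalGroup_of_lieGroup I ∞ (G := G)
    refine SmoothLoop.continuous_iff.2 ⟨SmoothLoop.continuous_eval.inv, fun n => ?_⟩
    have h := ((SmoothLoop.isCkFamily_adjointCLM (I := I) (G := G) n).clm_apply
      (SmoothLoop.isCkFamily_logDeriv n)).neg
    convert! h using 3
    exact SmoothLoop.logDeriv_inv _ _

variable (I G) in
theorem CircleConnection.continuous_pullback :
    Continuous fun p : CircleConnection I G × SmoothLoop I G => p.1.pullback p.2 := by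
  refine CircleConnection.continuous_iff.2 fun n => ?_
  have h := (((SmoothLoop.isCkFamily_adjointCLM_inv (I := I) (G := G) n).comp
    (Y := CircleConnection I G × SmoothLoop I G) continuous_snd).clm_apply
      ((CircleConnection.isCkFamily_coeff n).comp continuous_fst)).add
        ((SmoothLoop.isCkFamily_logDeriv n).comp continuous_snd)
  convert! h using 3
  exact CircleConnection.coeff_pullback _ _ _

end Topologies

theorem rightActionGroupoid_isTopological {X Γ : Type*} [TopologicalSpace X] [TopologicalSpace Γ]
    [Group Γ] [IsTopologicalGroup Γ] {act : X → Γ → X} (act_one : ∀ x, act x 1 = x)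
    (act_mul : ∀ x g h, act x (g * h) = act (act x g) h)
    (hact : Continuous fun p : X × Γ => act p.1 p.2) :
    (rightActionGroupoid act act_one act_mul).IsTopological where
  continuous_s := continuous_fst
  continuous_t := hact
  continuous_e := continuous_id.prodMk continuous_const
  continuous_i := hact.prodMk continuous_snd.inv
  continuous_m := by
    have h : Continuous fun p : {p : (X × Γ) × (X × Γ) // act p.1.1 p.1.2 = p.2.1} =>
        (p.1.1.1, p.1.1.2 * p.1.2.2) := by fun_prop
    exact h

/-! ### Parallel transport and holonomy -/

section Holonomy

variable {E : Type*} [NormedAddCommGroup E] [NormedSpace ℝ E] [CompleteSpace E]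
  {H : Type*} [TopologicalSpace H] {I : ModelWithCorners ℝ E H}
  {G : Type*} [TopologicalSpace G] [ChartedSpace H G] [Group G]
  [LieGroup I ∞ G] [I.Boundaryless]

namespace CircleConnection

/-- The inverse of the horizontal lift of the circle which starts at the identity. -/
def transport (A : CircleConnection I G) : ℝ → G :=
  (exists_hasLeftLogDerivAt (I := I) (G := G) (A.contDiff_coeff.of_le (mod_cast le_top))).choose

theorem transport_zero (A : CircleConnection I G) : A.transport 0 = 1 :=
  (exists_hasLeftLogDerivAt (I := I) (G := G)
    (A.contDiff_coeff.of_le (mod_cast le_top))).choose_spec.1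

theorem hasLeftLogDerivAt_transport (A : CircleConnection I G) (θ : ℝ) :
    HasLeftLogDerivAt I A.transport (A.coeff θ) θ :=
  (exists_hasLeftLogDerivAt (I := I) (G := G)
    (A.contDiff_coeff.of_le (mod_cast le_top))).choose_spec.2 θ

theorem eq_transport {A : CircleConnection I G} {γ : ℝ → G} (h0 : γ 0 = 1)
    (h : ∀ θ, HasLeftLogDerivAt I γ (A.coeff θ) θ) : γ = A.transport :=
  eq_of_hasLeftLogDerivAt h A.hasLeftLogDerivAt_transport (a := 0) (by rw [h0, transport_zero])

theorem contMDiff_transport (A : CircleConnection I G) : ContMDiff 𝓘(ℝ, ℝ) I ∞ A.transport :=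
  contMDiff_of_hasLeftLogDerivAt A.contDiff_coeff A.hasLeftLogDerivAt_transport

theorem transport_add_two_pi (A : CircleConnection I G) (θ : ℝ) :
    A.transport (θ + 2 * Real.pi) = A.transport (2 * Real.pi) * A.transport θ := by
  have h : (fun τ => (A.transport (2 * Real.pi))⁻¹ * A.transport (τ + 2 * Real.pi)) =
      A.transport := by
    refine eq_transport (by simp) fun τ => HasLeftLogDerivAt.const_mul ?_ _
    have h1 := (A.hasLeftLogDerivAt_transport (τ + 2 * Real.pi)).comp_hasDerivAt
      (f := fun τ => τ + 2 * Real.pi) ((hasDerivAt_id τ).add_const _)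
    rwa [one_smul, A.coeff_periodic] at h1
  rw [← congrFun h θ, mul_inv_cancel_left]

theorem transport_pullback (A : CircleConnection I G) (g : SmoothLoop I G) (θ : ℝ) :
    (A.pullback g).transport θ = (g 1)⁻¹ * (A.transport θ * g (Circle.exp θ)) := by
  have h : (fun τ => (g 1)⁻¹ * (A.transport τ * g (Circle.exp τ))) =
      (A.pullback g).transport := by
    refine eq_transport (by simp [transport_zero]) fun τ => HasLeftLogDerivAt.const_mul ?_ _
    rw [coeff_pullback]
    exact (A.hasLeftLogDerivAt_transport τ).mul (g.hasLeftLogDerivAt τ)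
  exact (congrFun h θ).symm

/-- The holonomy of a connection around the circle. -/
def hol (A : CircleConnection I G) : G := (A.transport (2 * Real.pi))⁻¹

theorem hasHolonomy_iff (A : CircleConnection I G) (x : G) : A.HasHolonomy x ↔ x = A.hol := by
  constructor
  · rintro ⟨u, hu, h0, rfl, hh⟩
    have h : (fun τ => (u τ)⁻¹) = A.transport := by
      refine eq_transport (by simp [h0]) fun θ => ?_
      have hl := hasLeftLogDerivAt_of_contMDiffAt (hu.mdifferentiableAt (x := θ) (by simp))
      have h1 := (A.form_curve (hu.mdifferentiableAt (by simp)) hl).symm.trans (hh θ)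
      have key : ∀ ξ : E, HasLeftLogDerivAt I u ξ θ →
          adjointCLM I (u θ)⁻¹ (A.coeff θ) + ξ = 0 →
          HasLeftLogDerivAt I (fun τ => (u τ)⁻¹) (A.coeff θ) θ := fun ξ hξ e => by
        have h2 := hξ.inv
        rwa [eq_neg_of_add_eq_zero_right e, map_neg, neg_neg, adjointCLM_apply_inv] at h2
      exact key _ hl h1
    rw [hol, ← congrFun h (2 * Real.pi), inv_inv]
  · rintro rfl
    have hs : ContMDiff 𝓘(ℝ, ℝ) I ∞ (fun τ => (A.transport τ)⁻¹) := A.contMDiff_transport.inv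
    refine ⟨fun τ => (A.transport τ)⁻¹, hs, by simp [transport_zero], rfl, fun θ => ?_⟩
    rw [A.form_curve (hs.mdifferentiableAt (by simp)) (A.hasLeftLogDerivAt_transport θ).inv,
      inv_inv, add_neg_cancel]
    rfl

theorem hol_pullback (A : CircleConnection I G) (g : SmoothLoop I G) :
    (A.pullback g).hol = (g 1)⁻¹ * A.hol * g 1 := by
  have h := Circle.periodic_exp 0
  rw [zero_add, Circle.exp_zero] at h
  rw [hol, transport_pullback, h, hol]
  group

/-- The loop which transforms a connection into another one with conjugate holonomy. -/
def gaugeLoop (A B : CircleConnection I G) (h : G) (hAB : B.hol = h⁻¹ * A.hol * h) :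
    SmoothLoop I G :=
  loopOfPeriodic (fun θ => (A.transport θ)⁻¹ * h * B.transport θ)
    ((A.contMDiff_transport.inv.mul contMDiff_const).mul B.contMDiff_transport) (by
      intro θ
      have h1 : A.transport (2 * Real.pi) = A.hol⁻¹ := (inv_inv _).symm
      have h2 : B.transport (2 * Real.pi) = B.hol⁻¹ := (inv_inv _).symm
      simp only [transport_add_two_pi, h1, h2, hAB]
      group)

theorem gaugeLoop_circleExp {A B : CircleConnection I G} {h : G}
    (hAB : B.hol = h⁻¹ * A.hol * h) (θ : ℝ) :
    gaugeLoop A B h hAB (Circle.exp θ) = (A.transport θ)⁻¹ * h * B.transport θ :=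
  loopOfPeriodic_circleExp _ _ θ

theorem gaugeLoop_one {A B : CircleConnection I G} {h : G} (hAB : B.hol = h⁻¹ * A.hol * h) :
    gaugeLoop A B h hAB 1 = h := by
  have h1 := gaugeLoop_circleExp hAB 0
  rwa [Circle.exp_zero, transport_zero, transport_zero, inv_one, one_mul, mul_one] at h1

theorem logDeriv_gaugeLoop {A B : CircleConnection I G} {h : G}
    (hAB : B.hol = h⁻¹ * A.hol * h) (θ : ℝ) :
    (gaugeLoop A B h hAB).logDeriv θ =
      -adjointCLM I (gaugeLoop A B h hAB (Circle.exp θ))⁻¹ (A.coeff θ) + B.coeff θ := by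
  have h1 := ((A.hasLeftLogDerivAt_transport θ).inv.mul_const h).mul
    (B.hasLeftLogDerivAt_transport θ)
  have h2 := (gaugeLoop A B h hAB).hasLeftLogDerivAt θ
  simp only [gaugeLoop_circleExp] at h2
  rw [h2.unique h1, gaugeLoop_circleExp, map_neg, map_neg]
  simp only [mul_inv_rev, inv_inv, adjointCLM_mul, ContinuousLinearMap.comp_apply]

theorem pullback_gaugeLoop {A B : CircleConnection I G} {h : G}
    (hAB : B.hol = h⁻¹ * A.hol * h) : A.pullback (gaugeLoop A B h hAB) = B := by
  refine ext_coeff fun θ => ?_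
  rw [coeff_pullback, logDeriv_gaugeLoop, add_neg_cancel_left]

theorem gaugeLoop_pullback (A : CircleConnection I G) (g : SmoothLoop I G) :
    gaugeLoop A (A.pullback g) (g 1) (A.hol_pullback g) = g := by
  refine ContMDiffMap.ext fun z => ?_
  obtain ⟨θ, rfl⟩ := circleExp_surjective z
  rw [gaugeLoop_circleExp, transport_pullback]
  group

end CircleConnection

end Holonomy

theorem continuous_prod_circle_iff {X Y : Type*} [TopologicalSpace X] [TopologicalSpace Y]
    {f : X × Circle → Y} :
    Continuous f ↔ Continuous fun p : X × ℝ => f (p.1, Circle.exp p.2) := by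
  have h : IsOpenQuotientMap (Circle.exp : ℝ → Circle) :=
    ⟨circleExp_surjective, Circle.exp.continuous, isLocalHomeomorph_circleExp.isOpenMap⟩
  exact (IsOpenQuotientMap.id.prodMap h).isQuotientMap.continuous_iff

section HolonomyContinuity

variable {E : Type*} [NormedAddCommGroup E] [NormedSpace ℝ E] [FiniteDimensional ℝ E]
  [CompleteSpace E]
  {H : Type*} [TopologicalSpace H] {I : ModelWithCorners ℝ E H}
  {G : Type*} [TopologicalSpace G] [ChartedSpace H G] [Group G]
  [LieGroup I ∞ G] [I.Boundaryless] [T2Space G]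

namespace CircleConnection

theorem continuous_transport :
    Continuous fun p : CircleConnection I G × ℝ => p.1.transport p.2 :=
  continuous_uncurry_of_hasLeftLogDerivAt (isCkFamily_coeff 0).continuous transport_zero
    fun A θ => A.hasLeftLogDerivAt_transport θ

theorem continuous_hol : Continuous fun A : CircleConnection I G => A.hol := by
  have := topologicalGroup_of_lieGroup I ∞ (G := G)
  exact (continuous_transport.comp (continuous_id.prodMk continuous_const)).inv

theorem continuous_gaugeLoop {X : Type*} [TopologicalSpace X] {A B : X → CircleConnection I G}
    {h : X → G} (hA : Continuous A) (hB : Continuous B) (hh : Continuous h)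
    (hAB : ∀ x, (B x).hol = (h x)⁻¹ * (A x).hol * h x) :
    Continuous fun x => gaugeLoop (A x) (B x) (h x) (hAB x) := by
  have := topologicalGroup_of_lieGroup I ∞ (G := G)
  have hc : Continuous fun p : X × ℝ =>
      gaugeLoop (A p.1) (B p.1) (h p.1) (hAB p.1) (Circle.exp p.2) := by
    simp only [gaugeLoop_circleExp]
    refine ((continuous_transport.comp ((hA.comp continuous_fst).prodMk continuous_snd)).inv.mul
      (hh.comp continuous_fst)).mul
      (continuous_transport.comp ((hB.comp continuous_fst).prodMk continuous_snd))
  refine SmoothLoop.continuous_iff.2 ⟨continuous_prod_circle_iff.2 hc, ?_⟩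
  have key : ∀ n, (IsCkFamily n fun x θ =>
      adjointCLM I (gaugeLoop (A x) (B x) (h x) (hAB x) (Circle.exp θ))⁻¹) →
      IsCkFamily n fun x => (gaugeLoop (A x) (B x) (h x) (hAB x)).logDeriv := fun n hn => by
    have h1 := ((hn.clm_apply (continuous_iff.1 hA n)).neg).add (continuous_iff.1 hB n)
    convert! h1 using 3
    exact logDeriv_gaugeLoop _ _
  intro n
  refine key n ?_
  induction n with
  | zero =>
    refine ⟨fun x => ((contMDiff_adjointCLM (I := I) (G := G)).comp
      (gaugeLoop (A x) (B x) (h x) (hAB x)).contMDiff_comp_circleExp.inv).contDiff,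
      fun k hk => ?_⟩
    obtain rfl : k = 0 := by omega
    simp only [iteratedDeriv_zero]
    exact continuous_adjointCLM.comp hc.inv
  | succ n ih =>
    exact IsCkFamily.adjointCLM_inv hc (fun x θ => SmoothLoop.hasLeftLogDerivAt _ θ) (key n ih)

end CircleConnection

variable (I G) in
/-- The morphism from the groupoid of connections to the conjugation groupoid given by the
holonomy. -/
def holonomyHom : SpaceGroupoid.Hom (connectionGroupoid I G) (conjugationGroupoid G) where
  obj := CircleConnection.hol (I := I) (G := G)
  arr a := ((CircleConnection.hol (I := I) a.1 : G), (a.2 : SmoothLoop I G) 1)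
  continuous_obj := CircleConnection.continuous_hol (I := I) (G := G)
  continuous_arr := by
    have h : Continuous fun a : CircleConnection I G × SmoothLoop I G => (a.1.hol, a.2 1) :=
      (CircleConnection.continuous_hol.comp continuous_fst).prodMk
        (SmoothLoop.continuous_eval.comp (continuous_snd.prodMk continuous_const))
    exact h
  map_s _ := rfl
  map_t a := (CircleConnection.hol_pullback a.1 a.2).symm
  map_e _ := rfl
  map_i a := Prod.ext (CircleConnection.hol_pullback a.1 a.2) rfl
  map_m _ := rfl

variable (I G) in
theorem isHomeomorph_holonomyHom_toArrowPullback :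
    IsHomeomorph (holonomyHom I G).toArrowPullback := by
  let P := {q : (CircleConnection I G × CircleConnection I G) × (G × G) //
    (q.1.1.hol, q.1.2.hol) = (q.2.1, q.2.2⁻¹ * q.2.1 * q.2.2)}
  have hP : ∀ q : P, q.1.1.2.hol = q.1.2.2⁻¹ * q.1.1.1.hol * q.1.2.2 := fun q => by
    have h1 := congrArg Prod.fst q.2
    have h2 := congrArg Prod.snd q.2
    simp only at h1 h2
    rw [h2, h1]
  let f : CircleConnection I G × SmoothLoop I G → P := (holonomyHom I G).toArrowPullback
  have hf : ∀ a, (f a).1 = ((a.1, a.1.pullback a.2), (a.1.hol, a.2 1)) := fun a => rfl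
  let g : P → CircleConnection I G × SmoothLoop I G := fun q =>
    (q.1.1.1, CircleConnection.gaugeLoop q.1.1.1 q.1.1.2 q.1.2.2 (hP q))
  have hfc : Continuous f := by
    refine Continuous.subtype_mk (f := fun a : CircleConnection I G × SmoothLoop I G =>
      ((a.1, a.1.pullback a.2), (a.1.hol, a.2 1))) ?_ fun a => (f a).2
    exact (continuous_fst.prodMk (CircleConnection.continuous_pullback I G)).prodMk
      (holonomyHom I G).continuous_arr
  have hgc : Continuous g := by
    have h1 : Continuous fun q : P => q.1 := continuous_subtype_val
    exact (continuous_fst.comp (continuous_fst.comp h1)).prodMk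
      (CircleConnection.continuous_gaugeLoop (continuous_fst.comp (continuous_fst.comp h1))
        (continuous_snd.comp (continuous_fst.comp h1))
        (continuous_snd.comp (continuous_snd.comp h1)) hP)
  have hgf : Function.LeftInverse g f := fun a =>
    Prod.ext rfl (CircleConnection.gaugeLoop_pullback a.1 a.2)
  have hfg : Function.RightInverse g f := fun q => by
    refine Subtype.ext ?_
    rw [hf]
    refine Prod.ext (Prod.ext rfl (CircleConnection.pullback_gaugeLoop (hP q)))
      (Prod.ext ?_ (CircleConnection.gaugeLoop_one (hP q)))
    exact (Prod.ext_iff.1 q.2).1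
  exact isHomeomorph_iff_exists_inverse.2 ⟨hfc, g, hgf, hfg, hgc⟩

end HolonomyContinuity

/-- The identity of the action groupoid of a continuous action is a Morita morphism. -/
theorem exists_isMorita_id {X Γ : Type*} [TopologicalSpace X] [TopologicalSpace Γ]
    [Group Γ] [IsTopologicalGroup Γ] {act : X → Γ → X} (act_one : ∀ x, act x 1 = x)
    (act_mul : ∀ x g h, act x (g * h) = act (act x g) h)
    (hact : Continuous fun p : X × Γ => act p.1 p.2) :
    ∃ Φ : SpaceGroupoid.Hom (rightActionGroupoid act act_one act_mul)
      (rightActionGroupoid act act_one act_mul), Φ.IsMorita := by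
  let K := rightActionGroupoid act act_one act_mul
  let Φ : SpaceGroupoid.Hom K K :=
    { obj := id, arr := id, continuous_obj := continuous_id, continuous_arr := continuous_id,
      map_s := fun _ => rfl, map_t := fun _ => rfl, map_e := fun _ => rfl, map_i := fun _ => rfl,
      map_m := fun _ => rfl }
  let P := {q : X × (X × Γ) // q.1 = act q.2.1 q.2.2}
  have hopen : IsOpenMap fun q : P => q.1.2.1 := by
    let e : P ≃ₜ X × Γ :=
      { toFun := fun q => q.1.2
        invFun := fun a => ⟨(act a.1 a.2, a), rfl⟩
        left_inv := fun q => Subtype.ext (Prod.ext q.2.symm rfl)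
        right_inv := fun _ => rfl
        continuous_toFun := continuous_snd.comp continuous_subtype_val
        continuous_invFun := (hact.prodMk continuous_id).subtype_mk _ }
    exact isOpenMap_fst.comp e.isOpenMap
  refine ⟨Φ, ⟨?_, hopen, fun x => ⟨⟨(act x 1, (x, 1)), rfl⟩, rfl⟩⟩⟩
  let Q := {q : (X × X) × (X × Γ) // (q.1.1, q.1.2) = (q.2.1, act q.2.1 q.2.2)}
  let f : X × Γ → Q := Φ.toArrowPullback
  have hfc : Continuous f :=
    Continuous.subtype_mk (f := fun a : X × Γ => ((a.1, act a.1 a.2), a))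
      ((continuous_fst.prodMk hact).prodMk continuous_id) fun a => (f a).2
  have h : IsHomeomorph f := isHomeomorph_iff_exists_inverse.2
    ⟨hfc, fun q => q.1.2, fun _ => rfl, fun q => Subtype.ext (Prod.ext q.2.symm rfl),
      continuous_snd.comp continuous_subtype_val⟩
  exact h

/-! ### Deformation of a connection and of its holonomy -/

namespace IsCkFamily

section

variable {V : Type*} [NormedAddCommGroup V] [NormedSpace ℝ V] {X : Type*} [TopologicalSpace X]
  {n : ℕ}

theorem of_param {f : X → V} (hf : Continuous f) : IsCkFamily n fun x (_ : ℝ) => f x := by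
  refine ⟨fun x => contDiff_const, fun k _ => ?_⟩
  simp only [iteratedDeriv_const]
  split_ifs
  · exact hf.comp continuous_fst
  · exact continuous_const

/-- A family which is locally in time a translate of another one. -/
theorem of_eqOn_translate {f g : X → ℝ → V} (hf : IsCkFamily n f)
    (h : ∀ θ₀ : ℝ, ∃ c : ℝ, ∀ᶠ θ in 𝓝 θ₀, ∀ x, g x θ = f x (θ - c)) : IsCkFamily n g := by
  have key : ∀ θ₀ : ℝ, ∃ c : ℝ, ∀ᶠ θ in 𝓝 θ₀, ∀ x, g x =ᶠ[𝓝 θ] fun τ => f x (τ - c) := fun θ₀ => by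
    obtain ⟨c, hc⟩ := h θ₀
    refine ⟨c, hc.eventually_nhds.mono fun θ hθ x => hθ.mono fun τ hτ => hτ x⟩
  refine ⟨fun x => contDiff_iff_contDiffAt.2 fun θ => ?_, fun k hk =>
    continuous_iff_continuousAt.2 fun ⟨x, θ⟩ => ?_⟩
  · obtain ⟨c, hc⟩ := key θ
    exact ((hf.1 x).comp (contDiff_id.sub contDiff_const)).contDiffAt.congr_of_eventuallyEq
      (hc.self_of_nhds x)
  · obtain ⟨c, hc⟩ := key θ
    have h1 : Continuous fun p : X × ℝ => iteratedDeriv k (f p.1) (p.2 - c) :=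
      (hf.2 k hk).comp (continuous_fst.prodMk (continuous_snd.sub continuous_const))
    refine h1.continuousAt.congr ?_
    filter_upwards [hc.prod_inr_nhds x] with p hp
    rw [(hp p.1).iteratedDeriv_eq k, iteratedDeriv_comp_sub_const]

end

theorem comp_contDiffOn.{u} {V Z : Type u} [NormedAddCommGroup V] [NormedSpace ℝ V]
    [NormedAddCommGroup Z] [NormedSpace ℝ Z] {X : Type*} [TopologicalSpace X] {n : ℕ}
    {s : Set V} (hs : IsOpen s) {m : V → Z} (hm : ContDiffOn ℝ ∞ m s) {y : X → ℝ → V}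
    (hy : IsCkFamily n y) (hys : ∀ x θ, y x θ ∈ s) : IsCkFamily n fun x θ => m (y x θ) := by
  have hc : ∀ {Z : Type u} [NormedAddCommGroup Z] [NormedSpace ℝ Z] {m : V → Z},
      ContDiffOn ℝ ∞ m s → Continuous fun p : X × ℝ => m (y p.1 p.2) := fun hm =>
    hm.continuousOn.comp_continuous hy.continuous fun p => hys p.1 p.2
  have hd : ∀ {Z : Type u} [NormedAddCommGroup Z] [NormedSpace ℝ Z] {m : V → Z},
      ContDiffOn ℝ ∞ m s → ∀ x, ContDiff ℝ ∞ fun θ => m (y x θ) := fun hm x =>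
    hm.comp_contDiff (hy.1 x) (hys x)
  induction n generalizing Z with
  | zero =>
    refine ⟨hd hm, fun k hk => ?_⟩
    obtain rfl : k = 0 := by omega
    simpa using hc hm
  | succ n ih =>
    have hm' : ContDiffOn ℝ ∞ (fderiv ℝ m) s := (contDiffOn_infty_iff_fderiv_of_isOpen hs).1 hm |>.2
    refine of_hasDerivAt (hc hm) (fun x θ => ?_)
      ((ih hm' (hy.of_le n.le_succ)).clm_apply (succ_iff.1 hy).2.2)
    exact (((hm.differentiableOn (by simp)).differentiableAt
      (hs.mem_nhds (hys x θ))).hasFDerivAt.comp_hasDerivAt θ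
        ((hy.1 x).differentiable (by simp) θ).hasDerivAt)

end IsCkFamily

section Periodization

variable {V : Type*} [NormedAddCommGroup V] [NormedSpace ℝ V]

/-- The `2π`-periodic function which agrees with `f` on `[0, 2π)`. -/
def periodize (f : ℝ → V) (θ : ℝ) : V := f (toIcoMod Real.two_pi_pos 0 θ)

theorem periodic_periodize (f : ℝ → V) : Function.Periodic (periodize f) (2 * Real.pi) := fun θ => by
  rw [periodize, toIcoMod_add_right, periodize]

theorem periodize_eq {f : ℝ → V} (h1 : ∀ θ < 1, f θ = 0) (h2 : ∀ θ, 2 < θ → f θ = 0) (m : ℤ)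
    {θ : ℝ} (hl : -1 < θ - m * (2 * Real.pi)) (hr : θ - m * (2 * Real.pi) < 2 * Real.pi + 1) :
    periodize f θ = f (θ - m * (2 * Real.pi)) := by
  have hpi := Real.pi_gt_three
  have hm := toIcoMod_mem_Ico Real.two_pi_pos 0 θ
  set k := toIcoDiv Real.two_pi_pos 0 θ with hk
  have e : toIcoMod Real.two_pi_pos 0 θ = θ - k * (2 * Real.pi) := by
    rw [toIcoMod, zsmul_eq_mul]
  rw [periodize, e]
  rw [e, zero_add] at hm
  rcases lt_trichotomy k m with hkm | hkm | hkm
  · have h : (k : ℝ) + 1 ≤ m := mod_cast hkm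
    have h3 : (k + 1) * (2 * Real.pi) ≤ m * (2 * Real.pi) :=
      mul_le_mul_of_nonneg_right h Real.two_pi_pos.le
    rw [h1 (θ - m * (2 * Real.pi)) (by linarith [hm.2]), h2 _ (by linarith)]
  · rw [hkm]
  · have h : (m : ℝ) + 1 ≤ k := mod_cast hkm
    have h3 : (m + 1) * (2 * Real.pi) ≤ k * (2 * Real.pi) :=
      mul_le_mul_of_nonneg_right h Real.two_pi_pos.le
    rw [h2 (θ - m * (2 * Real.pi)) (by linarith [hm.1]), h1 _ (by linarith)]

theorem IsCkFamily.periodize {X : Type*} [TopologicalSpace X] {n : ℕ} {f : X → ℝ → V}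
    (hf : IsCkFamily n f) (h1 : ∀ x, ∀ θ < 1, f x θ = 0) (h2 : ∀ x θ, 2 < θ → f x θ = 0) :
    IsCkFamily n fun x => periodize (f x) := by
  refine hf.of_eqOn_translate fun θ₀ => ?_
  have hm := toIcoMod_mem_Ico Real.two_pi_pos 0 θ₀
  rw [toIcoMod, zsmul_eq_mul, zero_add] at hm
  refine ⟨toIcoDiv Real.two_pi_pos 0 θ₀ * (2 * Real.pi), ?_⟩
  have hc : ContinuousAt (fun θ => θ - toIcoDiv Real.two_pi_pos 0 θ₀ * (2 * Real.pi)) θ₀ := by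
    fun_prop
  filter_upwards [hc.eventually (lt_mem_nhds (show (-1 : ℝ) < _ by linarith [hm.1])),
    hc.eventually (gt_mem_nhds (show _ < 2 * Real.pi + 1 by linarith [hm.2]))] with θ hl hr x
  exact periodize_eq (h1 x) (h2 x) _ hl hr

end Periodization

/-- A smooth step function from `0` to `1` on the interval `[1, 2]`. -/
def smoothStep (θ : ℝ) : ℝ := Real.smoothTransition (θ - 1)

theorem contDiff_smoothStep : ContDiff ℝ ∞ smoothStep :=
  Real.smoothTransition.contDiff.comp (contDiff_id.sub contDiff_const)

theorem smoothStep_of_le_one {θ : ℝ} (h : θ ≤ 1) : smoothStep θ = 0 :=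
  Real.smoothTransition.zero_of_nonpos (by linarith)

theorem smoothStep_of_two_le {θ : ℝ} (h : 2 ≤ θ) : smoothStep θ = 1 :=
  Real.smoothTransition.one_of_one_le (by linarith)

theorem norm_smoothStep_le (θ : ℝ) : ‖smoothStep θ‖ ≤ 1 := by
  rw [smoothStep, Real.norm_of_nonneg (Real.smoothTransition.nonneg _)]
  exact Real.smoothTransition.le_one _

theorem deriv_smoothStep_of_lt_one {θ : ℝ} (h : θ < 1) : deriv smoothStep θ = 0 := by
  have e : smoothStep =ᶠ[𝓝 θ] fun _ => 0 :=
    (gt_mem_nhds h).mono fun τ hτ => smoothStep_of_le_one (le_of_lt hτ)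
  rw [e.deriv_eq, deriv_const]

theorem deriv_smoothStep_of_two_lt {θ : ℝ} (h : 2 < θ) : deriv smoothStep θ = 0 := by
  have e : smoothStep =ᶠ[𝓝 θ] fun _ => 1 :=
    (lt_mem_nhds h).mono fun τ hτ => smoothStep_of_two_le (le_of_lt hτ)
  rw [e.deriv_eq, deriv_const]

section Deformation

variable {E : Type*} [NormedAddCommGroup E] [NormedSpace ℝ E] [CompleteSpace E]
  {H : Type*} [TopologicalSpace H] {I : ModelWithCorners ℝ E H}
  {G : Type*} [TopologicalSpace G] [ChartedSpace H G] [Group G]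
  [LieGroup I ∞ G] [I.Boundaryless]

namespace CircleConnection

theorem exists_deformation (A : CircleConnection I G) {r : ℝ}
    (hr : ∀ q ∈ Metric.ball (0 : E) r, unitCoord I G + q ∈ (unitChart I G).target) :
    ∃ F : Metric.ball (0 : E) r → CircleConnection I G, Continuous F ∧
      (∀ q : Metric.ball (0 : E) r, q.1 = 0 → F q = A) ∧
      ∀ q, (F q).hol = A.hol * ((unitChart I G).symm (unitCoord I G + q.1))⁻¹ := by
  let y : Metric.ball (0 : E) r → ℝ → E := fun q θ => unitCoord I G + smoothStep θ • q.1
  have hy : ∀ q θ, y q θ ∈ (unitChart I G).target := fun q θ => by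
    refine hr _ (mem_ball_zero_iff.2 (lt_of_le_of_lt ?_ (mem_ball_zero_iff.1 q.2)))
    rw [norm_smul]
    exact mul_le_of_le_one_left (norm_nonneg _) (norm_smoothStep_le θ)
  let p : Metric.ball (0 : E) r → ℝ → E := fun q θ =>
    adjointCLM I (A.transport θ)⁻¹ (maurerCartanChart I G (y q θ) (deriv smoothStep θ • q.1))
  have hp1 : ∀ q, ∀ θ < 1, p q θ = 0 := fun q θ h => by
    simp only [p, deriv_smoothStep_of_lt_one h, zero_smul, map_zero]
  have hp2 : ∀ q θ, 2 < θ → p q θ = 0 := fun q θ h => by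
    simp only [p, deriv_smoothStep_of_two_lt h, zero_smul, map_zero]
  have hsmul : ∀ n {φ : ℝ → ℝ}, ContDiff ℝ ∞ φ →
      IsCkFamily n fun (q : Metric.ball (0 : E) r) θ => φ θ • q.1 := fun n φ hφ =>
    IsCkFamily.bilin (ContinuousLinearMap.lsmul ℝ ℝ) (IsCkFamily.const hφ)
      (IsCkFamily.of_param continuous_subtype_val)
  have hp : ∀ n, IsCkFamily n p := fun n => by
    have hy' : IsCkFamily n y := (IsCkFamily.const contDiff_const).add (hsmul n contDiff_smoothStep)
    have hA : ContDiff ℝ ∞ fun θ => adjointCLM I (A.transport θ)⁻¹ :=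
      ((contMDiff_adjointCLM (I := I) (G := G)).comp A.contMDiff_transport.inv).contDiff
    exact (IsCkFamily.const hA).clm_apply ((IsCkFamily.comp_contDiffOn
      (isOpen_unitChart_target I G)
      (fun z hz => (contDiffAt_maurerCartanChart hz).contDiffWithinAt) hy' hy).clm_apply
        (hsmul n (contDiff_infty_iff_deriv.1 contDiff_smoothStep).2))
  have hpp : ∀ n, IsCkFamily n fun q => periodize (p q) := fun n => (hp n).periodize hp1 hp2
  have hex : ∀ q, ∃ B : CircleConnection I G, B.coeff = fun θ => A.coeff θ + periodize (p q) θ :=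
    fun q => exists_coeff_eq (A.contDiff_coeff.add ((hpp 0).1 q)) fun θ => by
      rw [A.coeff_periodic θ, periodic_periodize (p q) θ]
  choose F hF using hex
  refine ⟨F, continuous_iff.2 fun n => ?_, fun q hq => ext_coeff fun θ => ?_, fun q => ?_⟩
  · simp only [hF]
    exact (IsCkFamily.const A.contDiff_coeff).add (hpp n)
  · rw [hF]
    simp [periodize, p, hq]
  · have h0 : (0 : ℝ) ∈ Ioo (-1) (2 * Real.pi + 1) := ⟨by linarith, by linarith [Real.pi_pos]⟩
    have h2 : 2 * Real.pi ∈ Ioo (-1) (2 * Real.pi + 1) :=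
      ⟨by linarith [Real.pi_pos], by linarith⟩
    have key := eqOn_of_hasLeftLogDerivAt (I := I) (c := (F q).coeff) isOpen_Ioo isPreconnected_Ioo
      (fun θ _ => (F q).hasLeftLogDerivAt_transport θ)
      (δ := fun θ => (unitChart I G).symm (y q θ) * A.transport θ) (fun θ hθ => by
        have hd : HasDerivAt (y q) (deriv smoothStep θ • q.1) θ :=
          ((contDiff_smoothStep.differentiable (by simp) θ).hasDerivAt.smul_const q.1).const_add _
        have h := (hasLeftLogDerivAt_symm_comp hd (hy q θ)).mul (A.hasLeftLogDerivAt_transport θ)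
        have e : periodize (p q) θ = p q θ := by
          have h3 := periodize_eq (hp1 q) (hp2 q) 0 (θ := θ) (by simpa using hθ.1)
            (by simpa using hθ.2)
          simpa using h3
        rw [add_comm] at h
        simpa only [hF, e] using h) h0 (by simp [transport_zero, y, smoothStep_of_le_one])
    have h3 := key h2
    simp only [y, smoothStep_of_two_le (by linarith [Real.pi_gt_three] : (2 : ℝ) ≤ 2 * Real.pi),
      one_smul] at h3
    rw [hol, h3, mul_inv_rev, hol]

end CircleConnection

end Deformation

section Openness

variable {E : Type*} [NormedAddCommGroup E] [NormedSpace ℝ E] [CompleteSpace E]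
  {H : Type*} [TopologicalSpace H] {I : ModelWithCorners ℝ E H}
  {G : Type*} [TopologicalSpace G] [ChartedSpace H G] [Group G]
  [LieGroup I ∞ G] [I.Boundaryless]

namespace CircleConnection

variable (I G) in
theorem exists_ball_subset_target : ∃ r > 0, ∀ q ∈ Metric.ball (0 : E) r,
    unitCoord I G + q ∈ (unitChart I G).target := by
  obtain ⟨r, hr, h⟩ := Metric.mem_nhds_iff.1 (unitChart_target_mem_nhds I G)
  refine ⟨r, hr, fun q hq => h ?_⟩
  rwa [mem_ball_iff_norm, add_sub_cancel_left, ← mem_ball_zero_iff]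

variable (I G) in
theorem eventually_exists_symm_eq {W : Set E} (hW : W ∈ 𝓝 (0 : E)) :
    ∀ᶠ x in 𝓝 (1 : G), ∃ q ∈ W, (unitChart I G).symm (unitCoord I G + q) = x := by
  have hc : ContinuousAt (fun x : G => unitChart I G x - unitCoord I G) 1 :=
    ((contMDiffAt_unitChart (mem_unitChart_source_one I G)).continuousAt).sub continuousAt_const
  have h0 : unitChart I G (1 : G) - unitCoord I G = 0 := by simp
  rw [← h0] at hW
  filter_upwards [hc.eventually hW, eventually_symm_leftInverse I G] with x hx h
  exact ⟨_, hx, by rw [add_sub_cancel, h]⟩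

variable (I G) in
theorem isOpenMap_hol : IsOpenMap fun A : CircleConnection I G => A.hol := by
  have := topologicalGroup_of_lieGroup I ∞ (G := G)
  refine isOpenMap_iff_nhds_le.2 fun A S hS => ?_
  obtain ⟨r, hr, hball⟩ := exists_ball_subset_target I G
  obtain ⟨F, hF, hF0, hFh⟩ := A.exists_deformation hball
  let z : Metric.ball (0 : E) r := ⟨0, Metric.mem_ball_self hr⟩
  have h1 : ∀ᶠ q in 𝓝 z, (F q).hol ∈ S := by
    have h2 : Tendsto F (𝓝 z) (𝓝 A) := by simpa only [hF0 z rfl] using hF.tendsto z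
    exact h2.eventually hS
  rw [nhds_subtype_eq_comap, eventually_comap] at h1
  have h3 := eventually_exists_symm_eq I G (h1.and (Metric.ball_mem_nhds (0 : E) hr))
  have h4 : Tendsto (fun y : G => y⁻¹ * A.hol) (𝓝 A.hol) (𝓝 1) := by
    have h : Continuous fun y : G => y⁻¹ * A.hol := by fun_prop
    simpa using h.tendsto A.hol
  filter_upwards [h4.eventually h3] with y hy
  obtain ⟨q, ⟨hqS, hq⟩, e⟩ := hy
  have h5 := hqS ⟨q, hq⟩ rfl
  rw [hFh] at h5
  simpa [e] using h5

variable (I G) in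
theorem surjective_hol [ConnectedSpace G] :
    Function.Surjective fun A : CircleConnection I G => A.hol := by
  have := topologicalGroup_of_lieGroup I ∞ (G := G)
  obtain ⟨r, hr, hball⟩ := exists_ball_subset_target I G
  obtain ⟨A₀, -⟩ := exists_coeff_eq (I := I) (G := G) (c := fun _ => 0) contDiff_const
    fun _ => rfl
  have key : ∀ᶠ x in 𝓝 (1 : G), ∀ A : CircleConnection I G,
      ∃ B : CircleConnection I G, B.hol = A.hol * x⁻¹ := by
    filter_upwards [eventually_exists_symm_eq I G (Metric.ball_mem_nhds 0 hr)] with x hx A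
    obtain ⟨q, hq, rfl⟩ := hx
    obtain ⟨F, -, -, hF⟩ := A.exists_deformation hball
    exact ⟨F ⟨q, hq⟩, hF _⟩
  have hdiv : ∀ y : G, Tendsto (fun z => y⁻¹ * z) (𝓝 y) (𝓝 1) := fun y => by
    have h : Continuous fun z => y⁻¹ * z := by fun_prop
    simpa using h.tendsto y
  have hopen : IsOpen (range fun A : CircleConnection I G => A.hol) :=
    (isOpenMap_hol I G).isOpen_range
  have hclosed : IsClosed (range fun A : CircleConnection I G => A.hol) := by
    refine isClosed_of_closure_subset fun y hy => ?_
    obtain ⟨_, hz, A, rfl⟩ := mem_closure_iff_nhds.1 hy _ ((hdiv y).eventually key)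
    obtain ⟨B, hB⟩ := hz A
    exact ⟨B, by simpa using hB⟩
  exact range_eq_univ.1 (IsClopen.eq_univ ⟨hclosed, hopen⟩ ⟨_, A₀, rfl⟩)

end CircleConnection

end Openness

section Morita

variable {E : Type*} [NormedAddCommGroup E] [NormedSpace ℝ E] [FiniteDimensional ℝ E]
  [CompleteSpace E]
  {H : Type*} [TopologicalSpace H] (I : ModelWithCorners ℝ E H)
  (G : Type*) [TopologicalSpace G] [ChartedSpace H G] [Group G]
  [LieGroup I ∞ G] [I.Boundaryless] [T2Space G] [ConnectedSpace G]

theorem isMorita_holonomyHom : (holonomyHom I G).IsMorita := by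
  have := topologicalGroup_of_lieGroup I ∞ (G := G)
  let P := {q : CircleConnection I G × (G × G) // q.1.hol = q.2.2⁻¹ * q.2.1 * q.2.2}
  have hopen : IsOpenMap fun q : P => q.1.2.1 := by
    let e : P ≃ₜ CircleConnection I G × G :=
      { toFun := fun q => (q.1.1, q.1.2.2)
        invFun := fun a => ⟨(a.1, (a.2 * a.1.hol * a.2⁻¹, a.2)), by group⟩
        left_inv := fun q => Subtype.ext (Prod.ext rfl (Prod.ext (by
          have h := q.2
          change q.1.2.2 * q.1.1.hol * q.1.2.2⁻¹ = q.1.2.1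
          rw [h]
          group) rfl))
        right_inv := fun _ => rfl
        continuous_toFun := by fun_prop
        continuous_invFun := by
          have h := (CircleConnection.continuous_hol (I := I) (G := G)).comp
            (continuous_fst (X := CircleConnection I G) (Y := G))
          exact (continuous_fst.prodMk (((continuous_snd.mul h).mul
            continuous_snd.inv).prodMk continuous_snd)).subtype_mk _ }
    let c : G × G ≃ₜ G × G :=
      { toFun := fun a => (a.2 * a.1 * a.2⁻¹, a.2)
        invFun := fun a => (a.2⁻¹ * a.1 * a.2, a.2)
        left_inv := fun a => Prod.ext (by group) rfl
        right_inv := fun a => Prod.ext (by group) rfl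
        continuous_toFun := by fun_prop
        continuous_invFun := by fun_prop }
    have h := isOpenMap_fst.comp (c.isOpenMap.comp
      (((CircleConnection.isOpenMap_hol I G).prodMap IsOpenMap.id).comp e.isOpenMap))
    convert! h using 2 with q
    exact congrArg (fun q : P => q.1.2.1) (e.symm_apply_apply q).symm
  refine ⟨isHomeomorph_holonomyHom_toArrowPullback I G, hopen, fun (x : G) => ?_⟩
  obtain ⟨A, hA⟩ := CircleConnection.surjective_hol I G x
  have h : ∃ q : P, q.1.2.1 = x := ⟨⟨(A, (x, 1)), by simpa using hA⟩, rfl⟩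
  exact h

end Morita

end

theorem mainTheorem11 {E : Type*} [NormedAddCommGroup E] [NormedSpace ℝ E] [FiniteDimensional ℝ E]
    {H : Type*} [TopologicalSpace H] (I : ModelWithCorners ℝ E H) [I.Boundaryless]
    (G : Type*) [TopologicalSpace G] [ChartedSpace H G] [Group G] [LieGroup I ∞ G]
    [T2Space G] [ConnectedSpace G] :
    (connectionGroupoid I G).IsTopological ∧
    (conjugationGroupoid G).IsTopological ∧
    SpaceGroupoid.MoritaEquivalent (connectionGroupoid I G) (conjugationGroupoid G) ∧
    ∃ Ψ : SpaceGroupoid.Hom (connectionGroupoid I G) (conjugationGroupoid G),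
      (∀ (A : CircleConnection I G) (x : G), A.HasHolonomy x ↔ x = Ψ.obj A) ∧
      (∀ (A : CircleConnection I G) (g : SmoothLoop I G), Ψ.arr (A, g) = (Ψ.obj A, g 1)) ∧
      Ψ.IsMorita := by
  have : CompleteSpace E := FiniteDimensional.complete ℝ E
  have := topologicalGroup_of_lieGroup I ∞ (G := G)
  have := SmoothLoop.isTopologicalGroup I G
  have hG : (connectionGroupoid I G).IsTopological :=
    rightActionGroupoid_isTopological _ _ (CircleConnection.continuous_pullback I G)
  obtain ⟨Φ, hΦ⟩ := exists_isMorita_id CircleConnection.pullback_one CircleConnection.pullback_mul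
    (CircleConnection.continuous_pullback I G)
  exact ⟨hG, rightActionGroupoid_isTopological _ _ (by fun_prop),
    ⟨connectionGroupoid I G, Φ, holonomyHom I G, hG, hΦ, isMorita_holonomyHom I G⟩,
    holonomyHom I G, CircleConnection.hasHolonomy_iff, fun _ _ => rfl, isMorita_holonomyHom I G⟩
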